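/- Let $\mathbf k$ be an algebraically closed field of characteristic $p>2$, and let $B$ be a finitely generated commutative $\mathbf k$-algebra with a $\mathbf k$-linear Poisson bracket $\{\ ,\ \}$. Let $A$ be a quantization of $B$: an associative $\mathbf k[[\hbar]]$-algebra which is topologically free over $\mathbf k[[\hbar]]$ (that is, $\hbar$-torsion-free, and $\hbar$-adically separated and complete), with $A/\hbar A=B$ and $\{a \bmod \hbar,\, b \bmod \hbar\}=\frac1\hbar[a,b] \bmod \hbar$ for all $a,b\in A$. Assume that $A$ is weakly central: for every $a\in A$ there is $a^{[p]}\in A$ such that $a^p-\hbar^{p-1}a^{[p]}$ lies in the center $Z(A)$ of $A$. A symplectic leaf of $\operatorname{Spec} B$ is a maximal locally closed connected subvariety $Y\subset \operatorname{Spec} B$ such that the ideal $I(\overline Y)$ of its closure is a Poisson ideal and $Y$ is a smooth symplectic variety under the induced Poisson bracket (i.e. the induced bracket is nondegenerate at every closed point of $Y$). Let $y\in\operatorname{Spec} B$ be a closed point, and let $Y$ be a symplectic leaf containing $y$, with $\dim Y=2n$. Let $M$ be an $A$-module which is finite and free over $\mathbf k[[\hbar]]$ and such that the $B$-module $M/\hbar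 M$ is supported on $y$, i.e. $\operatorname{Supp}_B(M/\hbar M)\subseteq\{y\}$. Then the rank of $M$ over $\mathbf k[[\hbar]]$ is divisible by $p^n$. -/

import Mathlib

/-- A Poisson bracket on a commutative `k`-algebra `B`: a `k`-bilinear alternating bracket which
satisfies the Jacobi identity and is a derivation in the second argument (hence, by antisymmetry,
in each argument). -/
structure PoissonBracket (k B : Type*) [CommRing k] [CommRing B] [Algebra k B] where
  bracket : B → B → B
  add_left : ∀ a b c, bracket (a + b) c = bracket a c + bracket b c
  smul_left : ∀ (r : k) (a b : B), bracket (r • a) b = r • bracket a b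
  self : ∀ a, bracket a a = 0
  add_right : ∀ a b c, bracket a (b + c) = bracket a b + bracket a c
  jacobi : ∀ a b c,
    bracket a (bracket b c) + bracket b (bracket c a) + bracket c (bracket a b) = 0
  leibniz : ∀ a b c, bracket a (b * c) = bracket a b * c + b * bracket a c

namespace PoissonBracket

section Basic

variable {k B : Type*} [CommRing k] [CommRing B] [Algebra k B] (P : PoissonBracket k B)

theorem bracket_swap (a b : B) : P.bracket a b = -P.bracket b a := by
  have h := P.self (a + b)
  rw [P.add_left, P.add_right, P.add_right, P.self, P.self] at h
  rw [zero_add, add_zero] at h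
  exact eq_neg_of_add_eq_zero_left h

/-- `I` is a Poisson ideal: `{B, I} ⊆ I`. -/
def IsPoissonIdeal (I : Ideal B) : Prop :=
  ∀ a : B, ∀ b ∈ I, P.bracket a b ∈ I

theorem sub_right (a b c : B) : P.bracket a (b - c) = P.bracket a b - P.bracket a c := by
  have h := P.add_right a (b - c) c
  rw [sub_add_cancel] at h
  rw [h, add_sub_cancel_right]

/-- The bracket induced on the quotient by a Poisson ideal, `{a + I, b + I} = {a, b} + I`. -/
def quotient {I : Ideal B} (hI : P.IsPoissonIdeal I) : PoissonBracket k (B ⧸ I) where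
  bracket := fun x y => Quotient.liftOn₂' x y
    (fun a b => Ideal.Quotient.mk I (P.bracket a b)) (by
      intro a₁ b₁ a₂ b₂ ha hb
      have ha' : a₁ - a₂ ∈ I := (Submodule.quotientRel_def I).mp ha
      have hb' : b₁ - b₂ ∈ I := (Submodule.quotientRel_def I).mp hb
      have e : P.bracket a₁ b₁ - P.bracket a₂ b₂
          = P.bracket a₁ (b₁ - b₂) - P.bracket b₂ (a₁ - a₂) := by
        rw [P.sub_right, P.sub_right, P.bracket_swap b₂ a₁, P.bracket_swap b₂ a₂]
        ring
      refine Ideal.Quotient.eq.mpr ?_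
      rw [e]
      exact I.sub_mem (hI _ _ hb') (hI _ _ ha'))
  add_left := by
    rintro ⟨a⟩ ⟨b⟩ ⟨c⟩
    exact congrArg (Ideal.Quotient.mk I) (P.add_left a b c)
  smul_left := by
    rintro r ⟨a⟩ ⟨b⟩
    exact congrArg (Ideal.Quotient.mk I) (P.smul_left r a b)
  self := by
    rintro ⟨a⟩
    exact congrArg (Ideal.Quotient.mk I) (P.self a)
  add_right := by
    rintro ⟨a⟩ ⟨b⟩ ⟨c⟩
    exact congrArg (Ideal.Quotient.mk I) (P.add_right a b c)
  jacobi := by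
    rintro ⟨a⟩ ⟨b⟩ ⟨c⟩
    exact congrArg (Ideal.Quotient.mk I) (P.jacobi a b c)
  leibniz := by
    rintro ⟨a⟩ ⟨b⟩ ⟨c⟩
    exact congrArg (Ideal.Quotient.mk I) (P.leibniz a b c)

/-- The bracket is nondegenerate at the closed point `m`: the alternating form
`(f, g) ↦ {f, g}(m)` on the cotangent space `m / m²` has zero kernel. -/
def NondegenerateAt (m : Ideal B) : Prop :=
  ∀ f ∈ m, (∀ g ∈ m, P.bracket f g ∈ m) → f ∈ m ^ 2

end Basic

section Leaf

variable {k B : Type*} [Field k] [CommRing B] [Algebra k B] (P : PoissonBracket k B)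

/-- `Y ⊆ Spec B` is a connected, locally closed subvariety (with its reduced structure), the ideal
`I` of its closure is a Poisson ideal, and `Y`, an open subset of `Spec (B / I)`, is smooth over `k`
and symplectic (the induced bracket is nondegenerate at every closed point of `Y`).
The field `k` is meant to be algebraically closed and `B` to be of finite type over `k`. -/
structure IsSymplecticSubvariety (Y : Set (PrimeSpectrum B)) : Prop where
  isLocallyClosed : IsLocallyClosed Y
  isConnected : IsConnected Y
  isPoissonIdeal : P.IsPoissonIdeal (PrimeSpectrum.vanishingIdeal (closure Y))
  smooth : ∀ q : PrimeSpectrum (B ⧸ PrimeSpectrum.vanishingIdeal (closure Y)),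
    PrimeSpectrum.comap (Ideal.Quotient.mk _) q ∈ Y → Algebra.IsSmoothAt k q.asIdeal
  nondegenerate : ∀ q : PrimeSpectrum (B ⧸ PrimeSpectrum.vanishingIdeal (closure Y)),
    PrimeSpectrum.comap (Ideal.Quotient.mk _) q ∈ Y → q.asIdeal.IsMaximal →
      (P.quotient isPoissonIdeal).NondegenerateAt q.asIdeal

/-- A symplectic leaf of `Spec B`: a maximal symplectic subvariety as above. -/
def IsSymplecticLeaf (Y : Set (PrimeSpectrum B)) : Prop :=
  Maximal P.IsSymplecticSubvariety Y

end Leaf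

end PoissonBracket

/-- A deformation quantization of the Poisson algebra `(B, P)`: an associative `k[[ħ]]`-algebra `A`
which is topologically free over `k[[ħ]]` (that is, `ħ`-torsion-free, and separated and complete for
the `ħ`-adic topology), with an identification `A / ħA = B` of `k`-algebras, given by the surjection
`ρ`, such that `{a mod ħ, b mod ħ} = (1/ħ)[a, b] mod ħ`. Here `ħ` is `PowerSeries.X`. -/
structure Quantization {k B : Type*} [Field k] [CommRing B] [Algebra k B]
    (P : PoissonBracket k B) (A : Type*) [Ring A] [Algebra (PowerSeries k) A] where
  torsionFree : ∀ a : A, (PowerSeries.X : PowerSeries k) • a = 0 → a = 0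
  complete : IsAdicComplete (Ideal.span {(PowerSeries.X : PowerSeries k)}) A
  ρ : A →+* B
  ρ_algebraMap : ∀ f : PowerSeries k,
    ρ (algebraMap (PowerSeries k) A f) = algebraMap k B (PowerSeries.constantCoeff f)
  ρ_surjective : Function.Surjective ρ
  ρ_eq_zero : ∀ a : A, ρ a = 0 → ∃ a' : A, a = (PowerSeries.X : PowerSeries k) • a'
  ρ_bracket : ∀ a b c : A, a * b - b * a = (PowerSeries.X : PowerSeries k) • c →
    ρ c = P.bracket (ρ a) (ρ b)

/-- The algebra `A` over `k[[ħ]]` is weakly central (in characteristic `p`): every `a` has an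
`a^{[p]}` with `a^p - ħ^{p-1} a^{[p]}` in the center of `A`. -/
def IsWeaklyCentral (k : Type*) [Field k] (p : ℕ) (A : Type*) [Ring A]
    [Algebra (PowerSeries k) A] : Prop :=
  ∀ a : A, ∃ a' : A,
    a ^ p - (PowerSeries.X : PowerSeries k) ^ (p - 1) • a' ∈ Subring.center A

/-- The `A`-submodule `ħM` of an `A`-module `M`. -/
def hbarSubmodule (k : Type*) [Field k] (A : Type*) [Ring A] [Algebra (PowerSeries k) A]
    (M : Type*) [AddCommGroup M] [Module A M] : Submodule A M where
  carrier := {m | ∃ m' : M, m = algebraMap (PowerSeries k) A PowerSeries.X • m'}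
  add_mem' := by
    rintro _ _ ⟨a, rfl⟩ ⟨b, rfl⟩
    exact ⟨a + b, (smul_add _ _ _).symm⟩
  zero_mem' := ⟨0, (smul_zero _).symm⟩
  smul_mem' := by
    rintro c _ ⟨a, rfl⟩
    exact ⟨c • a, by rw [smul_smul, smul_smul, Algebra.commutes]⟩

namespace Quantization

variable {k B : Type*} [Field k] [CommRing B] [Algebra k B] {P : PoissonBracket k B}
  {A : Type*} [Ring A] [Algebra (PowerSeries k) A]

/-- The reduction `M / ħM` of an `A`-module `M`, regarded as a `B`-module. -/
def Reduction (_Q : Quantization P A) (M : Type*) [AddCommGroup M] [Module A M] : Type _ :=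
  M ⧸ hbarSubmodule k A M

variable (Q : Quantization P A) (M : Type*) [AddCommGroup M] [Module A M]

instance : AddCommGroup (Q.Reduction M) :=
  inferInstanceAs (AddCommGroup (M ⧸ hbarSubmodule k A M))

/-- The action of `A` on `M / ħM`. -/
def reductionAction : A →+* AddMonoid.End (Q.Reduction M) :=
  Module.toAddMonoidEnd A (M ⧸ hbarSubmodule k A M)

theorem ker_le_ker_reductionAction : RingHom.ker Q.ρ ≤ RingHom.ker (Q.reductionAction M) := by
  intro a ha
  obtain ⟨a', rfl⟩ := Q.ρ_eq_zero a ha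
  refine AddMonoidHom.ext fun x => ?_
  obtain ⟨m, rfl⟩ := Submodule.Quotient.mk_surjective (hbarSubmodule k A M) x
  refine (Submodule.Quotient.mk_eq_zero _).mpr ⟨a' • m, ?_⟩
  change ((PowerSeries.X : PowerSeries k) • a') • m = _
  rw [Algebra.smul_def, mul_smul]

/-- The `B`-module structure on `M / ħM`, characterized by
`ρ(a) • (m mod ħM) = (a • m) mod ħM`. -/
noncomputable instance : Module B (Q.Reduction M) :=
  Module.compHom (Q.Reduction M)
    (Q.ρ.liftOfSurjective Q.ρ_surjective
      ⟨Q.reductionAction M, Q.ker_le_ker_reductionAction M⟩)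

theorem ρ_smul_mk (a : A) (m : M) :
    (Q.ρ a • (show Q.Reduction M from (hbarSubmodule k A M).mkQ m) : Q.Reduction M)
      = (hbarSubmodule k A M).mkQ (a • m) := by
  have h := Q.ρ.liftOfRightInverse_comp_apply _
    (Function.rightInverse_surjInv Q.ρ_surjective)
    ⟨Q.reductionAction M, Q.ker_le_ker_reductionAction M⟩ a
  exact congrArg (fun φ : AddMonoid.End (Q.Reduction M) =>
    φ ((hbarSubmodule k A M).mkQ m)) h

end Quantization

/-! Let `F` be an algebraic closure of the fraction field of `k⟦ħ⟧`, with a valuation ring `O`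
dominating `k⟦ħ⟧` and having residue field `k`. It suffices to treat a simple subquotient `W` of `F
⊗ M`. By Burnside's theorem `A` spans `End_F W`, so the `O`-span `Λ` of the image of `A` is a
lattice of rank `(dim W)²`. As the residue field of `O` is `k`, the reduction of `Λ` modulo the
maximal ideal is a quotient `B ⧸ J`, of dimension `(dim W)²` over `k`
(`finrank_quotient_reductionIdeal`).

The ideal `J` is Poisson (`isPoissonIdeal_reductionIdeal`). Weak centrality lifts the `p`-th power
of a function vanishing at `y` to a central element, which acts on `W` by a scalar; the support
condition puts that scalar in the maximal ideal of `O`, so the `p`-th power lies in `J`. The leaf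
provides `r ≥ 2n` functions at `y` with invertible bracket matrix. Their Hamiltonian derivations
make `B ⧸ J` a representation of Weyl type with `p`-nilpotent coordinates, so `p^r` divides `(dim
W)²` (`pow_dvd_finrank_quotient`). Hence `p^n` divides `dim W`. -/

/-! ### Divisibility of dimensions from Weyl-type relations. -/

section WeylAction

variable {k V : Type*} [Field k] [AddCommGroup V] [Module k V]

/-- If `[D, X] = 1` and `X v = 0`, then `X (D^[j+1] v) = -(j+1) D^[j] v`. -/
theorem apply_pow_succ_of_commutator_eq_one {X D : Module.End k V} (h : D * X - X * D = 1)
    {v : V} (hv : X v = 0) (j : ℕ) : X ((D ^ (j + 1)) v) = -((j + 1 : ℕ) : k) • (D ^ j) v := by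
  have hc : ∀ w, X (D w) = D (X w) - w := fun w => by
    have := LinearMap.congr_fun h w
    simp only [LinearMap.sub_apply, Module.End.mul_apply, Module.End.one_apply] at this
    rw [eq_sub_iff_add_eq, ← eq_sub_iff_add_eq', this]
  induction j with
  | zero => simp [hc, hv]
  | succ j ih =>
    rw [pow_succ', Module.End.mul_apply, hc, ih, map_smul, pow_succ' D j, Module.End.mul_apply]
    push_cast
    module

theorem pow_apply_pow_of_commutator_eq_one {X D : Module.End k V} (h : D * X - X * D = 1)
    {v : V} (hv : X v = 0) (j : ℕ) :
    (X ^ j) ((D ^ j) v) = ((-1) ^ j * (j.factorial : k)) • v := by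
  induction j with
  | zero => simp
  | succ j ih =>
    rw [pow_succ, Module.End.mul_apply, apply_pow_succ_of_commutator_eq_one h hv, map_smul, ih,
      smul_smul, Nat.factorial_succ]
    congr 1
    push_cast
    ring

/-- `X ^ j` maps `ker X^(j+1)` to `ker X` with kernel `ker X^j`. It is onto because `X^j D^j` acts
on `ker X` as `± j!`, which is nonzero for `j < p`. -/
theorem finrank_ker_pow_of_commutator_eq_one [FiniteDimensional k V] (p : ℕ) [Fact p.Prime]
    [CharP k p] {X D : Module.End k V} (h : D * X - X * D = 1) (j : ℕ) (hj : j ≤ p) :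
    Module.finrank k (LinearMap.ker (X ^ j)) = j * Module.finrank k (LinearMap.ker X) := by
  induction j with
  | zero =>
    have : LinearMap.ker (X ^ 0) = ⊥ := by simp [Module.End.one_eq_id]
    rw [this]; simp
  | succ j ih =>
    have hle : LinearMap.ker (X ^ j) ≤ LinearMap.ker (X ^ (j + 1)) := fun v hv => by
      rw [LinearMap.mem_ker] at hv ⊢
      rw [pow_succ', Module.End.mul_apply, hv, map_zero]
    have hmaps : ∀ v : LinearMap.ker (X ^ (j + 1)), (X ^ j) v.1 ∈ LinearMap.ker X := fun v => by
      obtain ⟨v, hv⟩ := v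
      rwa [LinearMap.mem_ker, pow_succ', Module.End.mul_apply] at hv
    let φ : LinearMap.ker (X ^ (j + 1)) →ₗ[k] LinearMap.ker X :=
      ((X ^ j).comp (LinearMap.ker (X ^ (j + 1))).subtype).codRestrict _ hmaps
    have hfac : ((-1) ^ j * (j.factorial : k)) ≠ 0 := by
      refine mul_ne_zero (pow_ne_zero _ (by simp)) ?_
      rw [Ne, CharP.cast_eq_zero_iff k p, (Fact.out : p.Prime).dvd_factorial]
      omega
    have hsurj : Function.Surjective φ := by
      rintro ⟨v, hv⟩
      rw [LinearMap.mem_ker] at hv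
      have h1 := pow_apply_pow_of_commutator_eq_one h hv j
      refine ⟨⟨((-1) ^ j * (j.factorial : k))⁻¹ • (D ^ j) v, ?_⟩, Subtype.ext ?_⟩
      · rw [LinearMap.mem_ker, pow_succ', Module.End.mul_apply, map_smul, h1, smul_smul,
          inv_mul_cancel₀ hfac, one_smul, hv]
      · change (X ^ j) (((-1) ^ j * (j.factorial : k))⁻¹ • (D ^ j) v) = v
        rw [map_smul, h1, smul_smul, inv_mul_cancel₀ hfac, one_smul]
    have hker : Module.finrank k (LinearMap.ker φ) = Module.finrank k (LinearMap.ker (X ^ j)) := by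
      have : LinearMap.ker φ = (LinearMap.ker (X ^ j)).comap (LinearMap.ker (X ^ (j + 1))).subtype := by
        ext v
        rw [LinearMap.mem_ker, Submodule.mem_comap, LinearMap.mem_ker, ← Subtype.coe_inj]
        rfl
      rw [this]
      exact (Submodule.comapSubtypeEquivOfLe hle).finrank_eq
    have := φ.finrank_range_add_finrank_ker
    rw [LinearMap.range_eq_top.mpr hsurj, finrank_top, hker, ih (by omega)] at this
    rw [← this]; ring

/-- A finite-dimensional space on which a Weyl algebra in `r` pairs of variables acts with the
multiplication operators being `p`-nilpotent has dimension divisible by `p ^ r`; the derivations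
need not commute with each other. -/
theorem pow_dvd_finrank_of_commutators (p : ℕ) [Fact p.Prime] [CharP k p] (r : ℕ)
    {V : Type*} [AddCommGroup V] [Module k V] [FiniteDimensional k V]
    (X D : Fin r → Module.End k V) (hX : ∀ i j, X i * X j = X j * X i)
    (hXp : ∀ i, X i ^ p = 0)
    (h : ∀ i j, D j * X i - X i * D j = if i = j then 1 else 0) :
    p ^ r ∣ Module.finrank k V := by
  induction r generalizing V with
  | zero => simp
  | succ r ih =>
    have h0 : D 0 * X 0 - X 0 * D 0 = 1 := by simpa using h 0 0
    -- As `X 0 ^ p = 0`, the whole space has dimension `p` times that of `ker (X 0)`. The other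
    -- operators commute with `X 0`, so they act on this kernel and the induction continues there.
    have hV := finrank_ker_pow_of_commutator_eq_one p h0 p le_rfl
    rw [hXp 0, LinearMap.ker_zero, finrank_top] at hV
    rw [hV, pow_succ']
    refine mul_dvd_mul_left p ?_
    have hXs : ∀ (i : Fin r), ∀ v ∈ LinearMap.ker (X 0), X i.succ v ∈ LinearMap.ker (X 0) := by
      intro i v hv
      rw [LinearMap.mem_ker] at hv ⊢
      have := LinearMap.congr_fun (hX 0 i.succ) v
      rw [Module.End.mul_apply, Module.End.mul_apply, hv, map_zero] at this
      exact this
    have hDs : ∀ (i : Fin r), ∀ v ∈ LinearMap.ker (X 0), D i.succ v ∈ LinearMap.ker (X 0) := by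
      intro i v hv
      rw [LinearMap.mem_ker] at hv ⊢
      have := LinearMap.congr_fun (h 0 i.succ) v
      rw [if_neg (Fin.succ_ne_zero i).symm] at this
      simp only [LinearMap.sub_apply, Module.End.mul_apply, hv, map_zero, zero_sub,
        LinearMap.zero_apply, neg_eq_zero] at this
      exact this
    refine ih (fun i => (X i.succ).restrict (hXs i)) (fun i => (D i.succ).restrict (hDs i)) ?_ ?_ ?_
    · intro i j
      ext v
      exact LinearMap.congr_fun (hX i.succ j.succ) v
    · intro i
      ext v
      rw [Module.End.pow_restrict]
      exact LinearMap.congr_fun (hXp i.succ) v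
    · intro i j
      ext v
      have := LinearMap.congr_fun (h i.succ j.succ) v
      simp only [Fin.succ_inj] at this
      by_cases hij : i = j
      · subst hij
        simpa using this
      · rw [if_neg hij] at this ⊢
        simpa using this

end WeylAction

/-! ### Finite-dimensional Poisson quotients. -/

section PoissonQuotient

variable {k B : Type*} [Field k] [CommRing B] [Algebra k B]

/-- The Hamiltonian derivation `{a, -}`. -/
def PoissonBracket.hamiltonian (P : PoissonBracket k B) (a : B) : Derivation k B B :=
  Derivation.mk'
    { toFun := P.bracket a
      map_add' := P.add_right a
      map_smul' := fun r b => by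
        rw [P.bracket_swap, P.smul_left, P.bracket_swap a b, RingHom.id_apply, smul_neg] }
    (fun b c => by
      change P.bracket a (b * c) = b * P.bracket a c + c * P.bracket a b
      rw [P.leibniz]; ring)

@[simp]
theorem PoissonBracket.hamiltonian_apply (P : PoissonBracket k B) (a b : B) :
    P.hamiltonian a b = P.bracket a b := rfl

/-- If `p`-nilpotent elements `x i` admit derivations whose Jacobian matrix at `x` is invertible,
then the dimension of the algebra is divisible by `p ^ r`. -/
theorem pow_dvd_finrank_of_derivations (p : ℕ) [Fact p.Prime] [CharP k p] [FiniteDimensional k B]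
    {r : ℕ} (x : Fin r → B) (hx : ∀ i, x i ^ p = 0) (D : Fin r → Derivation k B B)
    (h : IsUnit (Matrix.of fun i j => D i (x j)).det) : p ^ r ∣ Module.finrank k B := by
  set G : Matrix (Fin r) (Fin r) B := Matrix.of fun i j => D i (x j) with hG
  -- Combining the derivations with the inverse Jacobian gives derivations dual to the `x i`. These
  -- have no reason to commute.
  refine pow_dvd_finrank_of_commutators p r (fun i => LinearMap.mulLeft k (x i))
    (fun i => ((∑ l, G⁻¹ i l • D l : Derivation k B B) : B →ₗ[k] B)) ?_ ?_ ?_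
  · intro i j
    ext b
    simp only [Module.End.mul_apply, LinearMap.mulLeft_apply]
    ring
  · intro i
    rw [LinearMap.pow_mulLeft, hx, LinearMap.mulLeft_zero_eq_zero]
  · intro i j
    have hij : (∑ l, G⁻¹ j l • D l : Derivation k B B) (x i) = if i = j then 1 else 0 := by
      have : (G⁻¹ * G) j i = (1 : Matrix (Fin r) (Fin r) B) j i := by
        rw [Matrix.nonsing_inv_mul _ h]
      rw [Matrix.mul_apply, Matrix.one_apply] at this
      simp only [eq_comm (a := i)]
      rw [← this, ← Derivation.coeFnAddMonoidHom_apply, map_sum, Finset.sum_apply]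
      rfl
    ext b
    simp only [LinearMap.sub_apply, Module.End.mul_apply, LinearMap.mulLeft_apply,
      Derivation.coeFn_coe, Derivation.leibniz, hij]
    split_ifs <;> simp

theorem PoissonBracket.pow_dvd_finrank_quotient (P : PoissonBracket k B) (p : ℕ) [Fact p.Prime]
    [CharP k p] {m J : Ideal B} [m.IsMaximal] (hJ : P.IsPoissonIdeal J)
    (hmJ : ∀ b ∈ m, b ^ p ∈ J) [FiniteDimensional k (B ⧸ J)] {r : ℕ} (x : Fin r → B)
    (hx : ∀ i, x i ∈ m) (h : (Matrix.of fun i j => P.bracket (x i) (x j)).det ∉ m) :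
    p ^ r ∣ Module.finrank k (B ⧸ J) := by
  refine pow_dvd_finrank_of_derivations p (fun i => Ideal.Quotient.mk J (x i)) (fun i => ?_)
    (fun i => (P.quotient hJ).hamiltonian (Ideal.Quotient.mk J (x i))) ?_
  · rw [← map_pow, Ideal.Quotient.eq_zero_iff_mem]
    exact hmJ _ (hx i)
  · set d := (Matrix.of fun i j => P.bracket (x i) (x j)).det with hd
    have : (Matrix.of fun i j => (P.quotient hJ).hamiltonian (Ideal.Quotient.mk J (x i))
        (Ideal.Quotient.mk J (x j))).det = Ideal.Quotient.mk J d := by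
      rw [hd, RingHom.map_det]
      rfl
    rw [this]
    -- `d` is invertible modulo `m`, and elements of `m` are nilpotent modulo `J`, so `d` is a unit
    -- modulo `J`.
    obtain ⟨u, v, hv, huv⟩ := Ideal.IsMaximal.exists_inv ‹_› h
    have hn : IsNilpotent (Ideal.Quotient.mk J v) :=
      ⟨p, by rw [← map_pow, Ideal.Quotient.eq_zero_iff_mem]; exact hmJ v hv⟩
    have : Ideal.Quotient.mk J u * Ideal.Quotient.mk J d = 1 - Ideal.Quotient.mk J v := by
      rw [← map_mul, ← map_one (Ideal.Quotient.mk J), ← huv, map_add, add_sub_cancel_right]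
    exact isUnit_of_mul_isUnit_right (this ▸ hn.isUnit_one_sub)

end PoissonQuotient

/-! ### Lattices over a valuation ring and their reduction to `B`. -/

section Reduction

open IsLocalRing

theorem Quantization.ρ_smul {k B A : Type*} [Field k] [CommRing B] [Algebra k B]
    {P : PoissonBracket k B} [Ring A] [Algebra (PowerSeries k) A] (Q : Quantization P A)
    (f : PowerSeries k) (a : A) : Q.ρ (f • a) = PowerSeries.constantCoeff f • Q.ρ a := by
  rw [Algebra.smul_def, map_mul, Q.ρ_algebraMap, ← Algebra.smul_def]

theorem Quantization.exists_commutator_eq {k B A : Type*} [Field k] [CommRing B] [Algebra k B]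
    {P : PoissonBracket k B} [Ring A] [Algebra (PowerSeries k) A] (Q : Quantization P A)
    (a b : A) : ∃ c : A, a * b - b * a = (PowerSeries.X : PowerSeries k) • c ∧
      Q.ρ c = P.bracket (Q.ρ a) (Q.ρ b) := by
  obtain ⟨c, hc⟩ := Q.ρ_eq_zero (a * b - b * a) (by
    rw [map_sub, map_mul, map_mul, mul_comm, sub_self])
  exact ⟨c, hc, Q.ρ_bracket a b c hc⟩

variable {k B A : Type*} [Field k] [CommRing B] [Algebra k B] {P : PoissonBracket k B} [Ring A]
  [Algebra (PowerSeries k) A] (Q : Quantization P A)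
  {O F E : Type*} [CommRing O] [IsDomain O] [ValuationRing O] [Field F] [Algebra O F]
  [IsFractionRing O F] [Algebra (PowerSeries k) O] [Ring E] [Algebra (PowerSeries k) E]
  [Algebra O E] [IsScalarTower (PowerSeries k) O E] [Algebra F E] [IsScalarTower O F E]

/-- The span over a valuation ring of the image of a quantization in a finite-dimensional algebra
has a basis consisting of elements of that image. -/
theorem exists_basis_span_range (F : Type*) [Field F] [Algebra O F]
    [IsFractionRing O F] [Algebra F E] [IsScalarTower O F E] (g : A →ₐ[PowerSeries k] E)
    (hfg : (LinearMap.range g.toLinearMap).FG) :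
    ∃ (n : ℕ) (a : Fin n → A), LinearIndependent O (fun i => g (a i)) ∧
      Submodule.span O (Set.range fun i => g (a i)) = Submodule.span O (Set.range g) := by
  set Λ : Submodule O E := Submodule.span O (Set.range g) with hΛ
  have hfin : Module.Finite O Λ := by
    obtain ⟨s, hs⟩ := hfg
    refine Module.Finite.iff_fg.mpr ⟨s, le_antisymm ?_ ?_⟩
    · refine Submodule.span_mono fun x hx => ?_
      have : x ∈ LinearMap.range g.toLinearMap := hs ▸ Submodule.subset_span hx
      exact this
    · rw [hΛ, Submodule.span_le]
      rintro _ ⟨a, rfl⟩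
      have : g a ∈ Submodule.span (PowerSeries k) (s : Set E) := hs ▸ ⟨a, rfl⟩
      exact Submodule.span_le_restrictScalars (PowerSeries k) O (s : Set E) this
  have htf : Module.IsTorsionFree O E := Module.IsTorsionFree.trans_faithfulSMul O F E
  -- A valuation ring is Bézout, so torsion-free means flat; finitely generated flat over a local
  -- ring means free. The basis can then be selected from the generators `v`, that is, from the
  -- image of `A`.
  have hflat : Module.Flat O Λ := by
    rw [Module.Flat.flat_iff_torsion_eq_bot_of_isBezout, ← Submodule.isTorsionFree_iff_torsion_eq_bot]
    infer_instance
  have hfree : Module.Free O Λ := Module.free_of_flat_of_isLocalRing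
  have hfp : Module.FinitePresentation O Λ := Module.finitePresentation_of_projective O Λ
  let v : A → Λ := fun a => ⟨g a, Submodule.subset_span ⟨a, rfl⟩⟩
  have hv : Submodule.span O (Set.range v) = ⊤ := by
    apply Submodule.map_injective_of_injective Λ.injective_subtype
    rw [Submodule.map_span, ← Set.range_comp, Submodule.map_top, Submodule.range_subtype]
    rfl
  obtain ⟨κ, a, b, hb⟩ := Module.exists_basis_of_span_of_flat v hv
  have hba : (fun i => g (a i)) = Λ.subtype ∘ b := funext fun i => by
    rw [Function.comp_apply, hb]; rfl
  have := Module.Finite.finite_basis b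
  let e := Finite.equivFin κ
  have hbe : (fun i => g (a (e.symm i))) = (Λ.subtype ∘ b) ∘ e.symm := by rw [← hba]; rfl
  refine ⟨Nat.card κ, a ∘ e.symm, ?_, ?_⟩
  · change LinearIndependent O (fun i => g (a (e.symm i)))
    rw [hbe]
    exact (b.linearIndependent.map' _ (LinearMap.ker_eq_bot.mpr Λ.injective_subtype)).comp _
      e.symm.injective
  · change Submodule.span O (Set.range (fun i => g (a (e.symm i)))) = _
    rw [hbe, e.symm.surjective.range_comp, Set.range_comp, ← Submodule.map_span, b.span_eq,
      Submodule.map_top, Submodule.range_subtype]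

/-- The ideal of `B` formed by the reductions of the elements of a quantization whose image in `E`
vanishes modulo the maximal ideal of `O`. -/
def Quantization.reductionIdeal (g : A →ₐ[PowerSeries k] E) : Ideal B where
  carrier := {b | ∃ a, Q.ρ a = b ∧ g a ∈ maximalIdeal O • Submodule.span O (Set.range g)}
  add_mem' := by
    rintro _ _ ⟨a, rfl, ha⟩ ⟨b, rfl, hb⟩
    exact ⟨a + b, map_add _ _ _, by rw [map_add]; exact add_mem ha hb⟩
  zero_mem' := ⟨0, map_zero _, by rw [map_zero]; exact zero_mem _⟩
  smul_mem' := by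
    rintro c _ ⟨a, rfl, ha⟩
    obtain ⟨c, rfl⟩ := Q.ρ_surjective c
    refine ⟨c * a, map_mul _ _ _, ?_⟩
    have h1 := Submodule.mem_map_of_mem (f := LinearMap.mulLeft O (g c)) ha
    rw [Submodule.map_smul'', LinearMap.mulLeft_apply, ← map_mul] at h1
    refine Submodule.smul_mono le_rfl ?_ h1
    rw [Submodule.map_span_le]
    rintro _ ⟨d, rfl⟩
    exact Submodule.subset_span ⟨c * d, map_mul _ _ _⟩

/-- The choice of lift is immaterial: two lifts differ by a multiple of `ħ`, which lies in the
maximal ideal of `O`. -/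
theorem Quantization.mem_reductionIdeal
    (hX : algebraMap (PowerSeries k) O PowerSeries.X ∈ maximalIdeal O)
    (g : A →ₐ[PowerSeries k] E) (a : A) :
    Q.ρ a ∈ Q.reductionIdeal (O := O) g ↔
      g a ∈ maximalIdeal O • Submodule.span O (Set.range g) := by
  refine ⟨?_, fun h => ⟨a, rfl, h⟩⟩
  rintro ⟨a', ha', h⟩
  obtain ⟨c, hc⟩ := Q.ρ_eq_zero (a - a') (by rw [map_sub, ha', sub_self])
  rw [← sub_add_cancel a a', map_add, hc, map_smul, ← algebraMap_smul O (PowerSeries.X : PowerSeries k)]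
  exact add_mem (Submodule.smul_mem_smul hX (Submodule.subset_span ⟨c, rfl⟩)) h

/-- Write `Λ` for the `O`-span of the image of `A`. Commutation with `g b` maps `Λ` into `ħΛ`, hence
`𝔪Λ` into `ħ𝔪Λ`; since `E` is torsion-free over `O`, the factor `ħ` cancels. -/
theorem Quantization.isPoissonIdeal_reductionIdeal
    (hX : algebraMap (PowerSeries k) O PowerSeries.X ∈ maximalIdeal O)
    (hX0 : algebraMap (PowerSeries k) O PowerSeries.X ≠ 0)
    (F : Type*) [Field F] [Algebra O F] [IsFractionRing O F] [Algebra F E] [IsScalarTower O F E]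
    (g : A →ₐ[PowerSeries k] E) : P.IsPoissonIdeal (Q.reductionIdeal (O := O) g) := by
  rintro b _ ⟨a, rfl, ha⟩
  obtain ⟨b, rfl⟩ := Q.ρ_surjective b
  obtain ⟨c, hc, hbr⟩ := Q.exists_commutator_eq b a
  rw [← hbr, Q.mem_reductionIdeal hX]
  set ϖ := algebraMap (PowerSeries k) O PowerSeries.X
  have htf : Module.IsTorsionFree O E := Module.IsTorsionFree.trans_faithfulSMul O F E
  have h1 := Submodule.mem_map_of_mem
    (f := LinearMap.mulLeft O (g b) - LinearMap.mulRight O (g b)) ha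
  rw [Submodule.map_smul'', LinearMap.sub_apply, LinearMap.mulLeft_apply, LinearMap.mulRight_apply,
    ← map_mul, ← map_mul, ← map_sub, hc, map_smul, ← algebraMap_smul O (PowerSeries.X : PowerSeries k)] at h1
  have h2 : ϖ • g c ∈ maximalIdeal O •
      (Submodule.span O (Set.range g)).map (LinearMap.lsmul O E ϖ) := by
    refine Submodule.smul_mono le_rfl ?_ h1
    rw [Submodule.map_span_le]
    rintro _ ⟨d, rfl⟩
    obtain ⟨e, he, -⟩ := Q.exists_commutator_eq b d
    refine ⟨g e, Submodule.subset_span ⟨e, rfl⟩, ?_⟩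
    rw [LinearMap.lsmul_apply, LinearMap.sub_apply, LinearMap.mulLeft_apply,
      LinearMap.mulRight_apply, ← map_mul, ← map_mul, ← map_sub, he, map_smul, algebraMap_smul]
  rw [← Submodule.map_smul''] at h2
  obtain ⟨w, hw, hwc⟩ := h2
  rw [LinearMap.lsmul_apply] at hwc
  rwa [← smul_right_injective E hX0 hwc]

/-- One family in `A` serves twice: its images form an `F`-basis of `E`, and its reductions form a
`k`-basis of the quotient of `B`. The residue condition `hres` lets `O`-coefficients be replaced by
constants from `k`. -/
theorem Quantization.finrank_quotient_reductionIdeal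
    (hX : algebraMap (PowerSeries k) O PowerSeries.X ∈ maximalIdeal O)
    (hres : ∀ u : O, ∃ c : k, u - algebraMap (PowerSeries k) O (PowerSeries.C c) ∈ maximalIdeal O)
    (g : A →ₐ[PowerSeries k] E) (hspan : Submodule.span F (Set.range g) = ⊤)
    (hfg : (LinearMap.range g.toLinearMap).FG) :
    FiniteDimensional k (B ⧸ Q.reductionIdeal (O := O) g) ∧
      Module.finrank k (B ⧸ Q.reductionIdeal (O := O) g) = Module.finrank F E := by
  obtain ⟨d, a, hli, hsp⟩ := exists_basis_span_range (O := O) F g hfg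
  set J := Q.reductionIdeal (O := O) g with hJ
  have hC : ∀ (c : k) (x : A), g (PowerSeries.C c • x) =
      algebraMap (PowerSeries k) O (PowerSeries.C c) • g x := fun c x => by
    rw [map_smul, algebraMap_smul]
  have hρ : ∀ c : Fin d → k, Q.ρ (∑ i, PowerSeries.C (c i) • a i) = ∑ i, c i • Q.ρ (a i) := fun c => by
    rw [map_sum]
    refine Finset.sum_congr rfl fun i _ => ?_
    rw [Q.ρ_smul, PowerSeries.constantCoeff_C]
  have hliF : LinearIndependent F (fun i => g (a i)) := (LinearIndependent.iff_fractionRing O F).mp hli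
  have hspF : ⊤ ≤ Submodule.span F (Set.range fun i => g (a i)) := by
    rw [← hspan, Submodule.span_le]
    intro x hx
    have : x ∈ Submodule.span O (Set.range fun i => g (a i)) := hsp ▸ Submodule.subset_span hx
    exact Submodule.span_le_restrictScalars O F _ this
  have hlik : LinearIndependent k (fun i => Ideal.Quotient.mk J (Q.ρ (a i))) := by
    rw [Fintype.linearIndependent_iff]
    intro c hc i
    have h1 : Ideal.Quotient.mk J (Q.ρ (∑ i, PowerSeries.C (c i) • a i)) = 0 := by
      rw [hρ, map_sum, ← hc]
      rfl
    rw [Ideal.Quotient.eq_zero_iff_mem, hJ, Q.mem_reductionIdeal hX, ← hsp,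
      Submodule.mem_ideal_smul_span_iff_exists_sum] at h1
    obtain ⟨f, hf, hfs⟩ := h1
    rw [Finsupp.sum_fintype _ _ (by simp), map_sum] at hfs
    simp only [hC] at hfs
    have h2 := Fintype.linearIndependent_iff.mp hli
      (fun i => f i - algebraMap (PowerSeries k) O (PowerSeries.C (c i)))
      (by simp only [sub_smul, Finset.sum_sub_distrib]; rw [hfs, sub_self]) i
    by_contra hci
    have h3 : IsUnit (algebraMap (PowerSeries k) O (PowerSeries.C (c i))) :=
      ((IsUnit.mk0 _ hci).map PowerSeries.C).map _
    rw [← sub_eq_zero.mp h2] at h3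
    exact (mem_maximalIdeal _).mp (hf i) h3
  have hspk : ⊤ ≤ Submodule.span k (Set.range fun i => Ideal.Quotient.mk J (Q.ρ (a i))) := by
    rintro x -
    obtain ⟨x, rfl⟩ := Ideal.Quotient.mk_surjective x
    obtain ⟨x, rfl⟩ := Q.ρ_surjective x
    have hx : g x ∈ Submodule.span O (Set.range fun i => g (a i)) :=
      hsp ▸ Submodule.subset_span ⟨x, rfl⟩
    obtain ⟨u, hu⟩ := (Submodule.mem_span_range_iff_exists_fun O).mp hx
    choose c hc using fun i => hres (u i)
    have h1 : Q.ρ (x - ∑ i, PowerSeries.C (c i) • a i) ∈ J := by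
      rw [hJ, Q.mem_reductionIdeal hX, map_sub, map_sum, ← hu, ← Finset.sum_sub_distrib]
      refine sum_mem fun i _ => ?_
      rw [hC, ← sub_smul]
      exact Submodule.smul_mem_smul (hc i) (Submodule.subset_span ⟨a i, rfl⟩)
    rw [map_sub, ← Ideal.Quotient.eq_zero_iff_mem, map_sub, sub_eq_zero, hρ] at h1
    rw [h1, map_sum]
    refine sum_mem fun i _ => ?_
    exact Submodule.smul_mem (Submodule.span k _) (c i) (Submodule.subset_span (Set.mem_range_self i))
  have bk := Module.Basis.mk hlik hspk
  exact ⟨bk.finiteDimensional_of_finite, by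
    rw [Module.finrank_eq_card_basis bk, Module.finrank_eq_card_basis (Module.Basis.mk hliF hspF)]⟩

/-- If a weakly central quantization acts densely on an `F`-algebra `E`, where `F` is the fraction
field of a valuation ring `O` dominating `k⟦ħ⟧`, and its central elements above `m` reduce to `0`,
then the rank of the Poisson bracket on `m / m²` bounds the `p`-adic valuation of `dim E`. -/
theorem Quantization.pow_dvd_finrank_of_dense (p : ℕ) [Fact p.Prime] [CharP k p]
    (hA : IsWeaklyCentral k p A)
    (hX : algebraMap (PowerSeries k) O PowerSeries.X ∈ maximalIdeal O)
    (hX0 : algebraMap (PowerSeries k) O PowerSeries.X ≠ 0)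
    (hres : ∀ u : O, ∃ c : k, u - algebraMap (PowerSeries k) O (PowerSeries.C c) ∈ maximalIdeal O)
    (g : A →ₐ[PowerSeries k] E) (hspan : Submodule.span F (Set.range g) = ⊤)
    (hfg : (LinearMap.range g.toLinearMap).FG)
    {m : Ideal B} [m.IsMaximal] {r : ℕ} (x : Fin r → B)
    (hx : ∀ i, x i ∈ m) (h : (Matrix.of fun i j => P.bracket (x i) (x j)).det ∉ m)
    (hz : ∀ z ∈ Subring.center A, Q.ρ z ∈ m → ∃ l ∈ maximalIdeal O, g z = algebraMap O E l) :
    p ^ r ∣ Module.finrank F E := by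
  obtain ⟨h1, h2⟩ := Q.finrank_quotient_reductionIdeal (F := F) hX hres g hspan hfg
  rw [← h2]
  refine P.pow_dvd_finrank_quotient p (m := m) (Q.isPoissonIdeal_reductionIdeal hX hX0 F g) ?_
    x hx h
  intro b hb
  obtain ⟨a, rfl⟩ := Q.ρ_surjective b
  have hp : p - 1 ≠ 0 := by have := (Fact.out : p.Prime).two_le; omega
  obtain ⟨a', ha'⟩ := hA a
  -- Since `p - 1 > 0`, the central element `z` reduces to `ρ(a)^p`.
  set z := a ^ p - (PowerSeries.X : PowerSeries k) ^ (p - 1) • a' with hzdef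
  have hρz : Q.ρ z = Q.ρ a ^ p := by
    rw [hzdef, map_sub, Q.ρ_smul, map_pow, map_pow, PowerSeries.constantCoeff_X, zero_pow hp,
      zero_smul, sub_zero]
  obtain ⟨l, hl, hgl⟩ := hz z ha' (by
    rw [hρz]; exact Ideal.pow_mem_of_mem m hb p (Fact.out : p.Prime).pos)
  rw [← hρz, Q.mem_reductionIdeal hX, hgl, Algebra.algebraMap_eq_smul_one]
  exact Submodule.smul_mem_smul hl (Submodule.subset_span ⟨1, map_one g⟩)

end Reduction

/-! ### Burnside's theorem and reduction to simple modules. -/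

section SimpleModules

variable {F S : Type*} [Field F] [Ring S] [Algebra F S]

/-- **Burnside's theorem**: a finite-dimensional simple module over an algebra over an algebraically
closed field is acted on by all linear endomorphisms. -/
theorem IsSimpleModule.lsmul_surjective [IsAlgClosed F] (W : Type*) [AddCommGroup W] [Module F W]
    [Module S W] [IsScalarTower F S W] [IsSimpleModule S W] [FiniteDimensional F W] :
    Function.Surjective (Algebra.lsmul F F W : S →ₐ[F] Module.End F W) := by
  intro T
  have hfin : Module.Finite (Module.End S W) W :=
    Module.Finite.of_restrictScalars_finite F (Module.End S W) W
  -- By Schur's lemma `End_S W` consists of scalars, so every `F`-linear map commutes with it and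
  -- the density theorem applies.
  let T' : Module.End (Module.End S W) W :=
    { toFun := T
      map_add' := T.map_add
      map_smul' := fun φ w => by
        obtain ⟨c, rfl⟩ := (IsSimpleModule.algebraMap_end_bijective_of_isAlgClosed F
          (A := S) (V := W)).2 φ
        simp }
  obtain ⟨s, hs⟩ := Module.Finite.toModuleEnd_moduleEnd_surjective (R := S) (M := W) T'
  exact ⟨s, LinearMap.ext fun w => LinearMap.congr_fun hs w⟩

universe w in
theorem dvd_finrank_of_forall_isSimpleModule (n : ℕ)
    (h : ∀ (W : Type w) [AddCommGroup W] [Module F W] [Module S W] [IsScalarTower F S W]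
      [FiniteDimensional F W] [IsSimpleModule S W], n ∣ Module.finrank F W)
    (W : Type w) [AddCommGroup W] [Module F W] [Module S W] [IsScalarTower F S W]
    [FiniteDimensional F W] : n ∣ Module.finrank F W := by
  induction hd : Module.finrank F W using Nat.strong_induction_on generalizing W with
  | _ d ih =>
    subst hd
    by_cases hs : IsSimpleModule S W
    · exact h W
    rcases subsingleton_or_nontrivial W with hW | hW
    · rw [Module.finrank_zero_of_subsingleton]
      exact dvd_zero n
    have : ∃ U : Submodule S W, U ≠ ⊥ ∧ U ≠ ⊤ := by
      by_contra! hU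
      refine hs (isSimpleModule_iff .. |>.mpr ⟨fun U => ?_⟩)
      exact or_iff_not_imp_left.mpr (hU U)
    obtain ⟨U, hU0, hU1⟩ := this
    have hsum := (U.restrictScalars F).finrank_quotient_add_finrank
    have e : Module.finrank F (W ⧸ U.restrictScalars F) = Module.finrank F (W ⧸ U) :=
      (Submodule.Quotient.restrictScalarsEquiv F U).finrank_eq
    have e' : Module.finrank F (U.restrictScalars F) = Module.finrank F U := rfl
    have hUfin : FiniteDimensional F U :=
      inferInstanceAs (FiniteDimensional F (U.restrictScalars F))
    have hUpos : 0 < Module.finrank F U := by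
      have := (Submodule.nontrivial_iff_ne_bot).mpr hU0
      exact Module.finrank_pos
    have hQpos : 0 < Module.finrank F (W ⧸ U) := by
      have := Submodule.Quotient.nontrivial_iff.mpr hU1
      exact Module.finrank_pos
    rw [e, e'] at hsum
    rw [← hsum]
    exact dvd_add (ih _ (by omega) (W ⧸ U) rfl) (ih _ (by omega) U rfl)

end SimpleModules

/-! ### A dominating valuation ring with residue field `k`. -/

section ValuationRing

/-- A field algebraic over the fraction field of a local domain `R` with algebraically closed
coefficient field `k` has a valuation ring which dominates `R` and has residue field `k`. -/
theorem exists_valuationSubring_residue (k : Type*) [Field k] [IsAlgClosed k] {F : Type*} [Field F]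
    [Algebra (PowerSeries k) F] [FaithfulSMul (PowerSeries k) F]
    [Algebra.IsAlgebraic (PowerSeries k) F] :
    ∃ O : ValuationSubring F, ∃ hO : ∀ r : PowerSeries k, algebraMap (PowerSeries k) F r ∈ O,
      (⟨_, hO PowerSeries.X⟩ : O) ∈ IsLocalRing.maximalIdeal O ∧
      ∀ u : O, ∃ c : k, u - ⟨_, hO (PowerSeries.C c)⟩ ∈ IsLocalRing.maximalIdeal O := by
  obtain ⟨O, hO, hloc⟩ := IsLocalRing.exists_factor_valuationRing (algebraMap (PowerSeries k) F)
  let φ : PowerSeries k →+* O := (algebraMap (PowerSeries k) F).codRestrict O.toSubring hO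
  have hX : φ PowerSeries.X ∈ IsLocalRing.maximalIdeal O := by
    rw [IsLocalRing.mem_maximalIdeal, mem_nonunits_iff]
    intro hu
    exact PowerSeries.X_prime.not_isUnit (hloc.map_nonunit _ hu)
  refine ⟨O, hO, hX, fun u => ?_⟩
  let res : PowerSeries k →+* IsLocalRing.ResidueField O := (IsLocalRing.residue O).comp φ
  let _ : Algebra k (IsLocalRing.ResidueField O) := (res.comp PowerSeries.C).toAlgebra
  have hres : ∀ f, res f = algebraMap k _ (PowerSeries.constantCoeff f) := by
    intro f
    obtain ⟨g, hg⟩ := PowerSeries.X_dvd_iff.mpr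
      (show PowerSeries.constantCoeff (f - PowerSeries.C (PowerSeries.constantCoeff f)) = 0 by simp)
    have : res (f - PowerSeries.C (PowerSeries.constantCoeff f)) = 0 := by
      rw [hg, map_mul]
      have : res PowerSeries.X = 0 := (IsLocalRing.residue_eq_zero_iff _).mpr hX
      rw [this, zero_mul]
    rw [map_sub, sub_eq_zero] at this
    exact this
  have halg : IsAlgebraic k (IsLocalRing.residue O u) := by
    obtain ⟨q, hq0, hq⟩ := Algebra.IsAlgebraic.isAlgebraic (R := PowerSeries k) (u : F)
    have hnu : ¬ IsUnit (Polynomial.C (PowerSeries.X : PowerSeries k)) := by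
      rw [Polynomial.isUnit_C]
      exact PowerSeries.X_prime.not_isUnit
    -- Removing the largest power of `ħ` from an equation for `u` leaves a polynomial that is
    -- nonzero modulo `ħ`; it witnesses that the residue of `u` is algebraic over `k`.
    obtain ⟨q', hq', hndvd⟩ :=
      (FiniteMultiplicity.of_not_isUnit hnu hq0).exists_eq_pow_mul_and_not_dvd
    have hX0 : algebraMap (PowerSeries k) F PowerSeries.X ≠ 0 := by
      rw [Ne, FaithfulSMul.algebraMap_eq_zero_iff]
      exact PowerSeries.X_ne_zero
    rw [hq', map_mul, map_pow, Polynomial.aeval_C] at hq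
    have hq1 := (mul_eq_zero.mp hq).resolve_left (pow_ne_zero _ hX0)
    refine ⟨q'.map PowerSeries.constantCoeff, fun h0 => hndvd ?_, ?_⟩
    · rw [Polynomial.C_dvd_iff_dvd_coeff]
      intro i
      rw [PowerSeries.X_dvd_iff, ← Polynomial.coeff_map, h0, Polynomial.coeff_zero]
    · have h1 : Polynomial.eval₂ φ u q' = 0 := by
        apply Subtype.val_injective
        have := Polynomial.hom_eval₂ q' φ O.subtype u
        exact this.trans hq1
      have h2 := Polynomial.hom_eval₂ q' φ (IsLocalRing.residue O) u
      rw [h1, map_zero] at h2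
      rw [Polynomial.aeval_def, Polynomial.eval₂_map]
      have : (algebraMap k (IsLocalRing.ResidueField O)).comp PowerSeries.constantCoeff = res :=
        RingHom.ext fun f => (hres f).symm
      rw [this]
      exact h2.symm
  obtain ⟨c, hc⟩ := minpoly.mem_range_of_degree_eq_one k (IsLocalRing.residue O u)
    (IsAlgClosed.degree_eq_one_of_irreducible k (minpoly.irreducible halg.isIntegral))
  refine ⟨c, ?_⟩
  rw [← IsLocalRing.residue_eq_zero_iff, map_sub, ← hc, sub_eq_zero]
  rfl

end ValuationRing

/-! ### Irreducible representations over `F`. -/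

section IrreducibleRepresentations

open IsLocalRing

/-- If a power of an element of the fraction field is a root of a monic polynomial whose
lower coefficients are divisible by `ħ`, then the element lies in the maximal ideal of a
valuation ring dominating `k⟦ħ⟧`. -/
theorem exists_mem_maximalIdeal_of_aeval_eq_zero {k O F : Type*} [Field k] [CommRing O]
    [IsDomain O] [ValuationRing O] [Field F] [Algebra O F] [IsFractionRing O F]
    [Algebra (PowerSeries k) O] [Algebra (PowerSeries k) F] [IsScalarTower (PowerSeries k) O F]
    (hX : algebraMap (PowerSeries k) O PowerSeries.X ∈ maximalIdeal O)
    {q : Polynomial (PowerSeries k)} (hq : q.Monic)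
    (hcoeff : ∀ i < q.natDegree, PowerSeries.X ∣ q.coeff i) {e : ℕ} (he : 0 < e) {l : F}
    (hl : Polynomial.aeval (l ^ e) q = 0) : ∃ u ∈ maximalIdeal O, algebraMap O F u = l := by
  have hint : IsIntegral O l := by
    refine IsIntegral.of_pow he ?_
    refine ⟨q.map (algebraMap _ O), hq.map _, ?_⟩
    rw [Polynomial.eval₂_map, ← IsScalarTower.algebraMap_eq]
    exact hl
  obtain ⟨u, rfl⟩ := IsIntegrallyClosed.isIntegral_iff.mp hint
  refine ⟨u, ?_, rfl⟩
  rw [← map_pow, Polynomial.aeval_algebraMap_apply, FaithfulSMul.algebraMap_eq_zero_iff,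
    Polynomial.aeval_eq_sum_range, Finset.sum_range_succ, hq.coeff_natDegree, one_smul] at hl
  -- Modulo the maximal ideal only the leading term of the monic equation survives.
  have h1 : (u ^ e) ^ q.natDegree ∈ maximalIdeal O := by
    rw [eq_neg_of_add_eq_zero_right hl]
    refine neg_mem (sum_mem fun i hi => ?_)
    obtain ⟨c, hc⟩ := hcoeff i (Finset.mem_range.mp hi)
    rw [hc, Algebra.smul_def, map_mul, mul_assoc]
    exact Ideal.mul_mem_right _ _ hX
  rw [← pow_mul] at h1
  exact Ideal.IsPrime.mem_of_pow_mem (maximalIdeal.isMaximal O).isPrime _ h1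

theorem AlgHom.fg_range_of_ker_le {R A E E' : Type*} [CommRing R] [Ring A] [Algebra R A] [Ring E]
    [Algebra R E] [Ring E'] [Algebra R E'] (ψ : A →ₐ[R] E) (g : A →ₐ[R] E')
    (h : ∀ a, ψ a = 0 → g a = 0) (hψ : (LinearMap.range ψ.toLinearMap).FG) :
    (LinearMap.range g.toLinearMap).FG := by
  have : Module.Finite R (LinearMap.range ψ.toLinearMap) := Module.Finite.iff_fg.mpr hψ
  have : Module.Finite R (A ⧸ LinearMap.ker ψ.toLinearMap) :=
    Module.Finite.equiv ψ.toLinearMap.quotKerEquivRange.symm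
  rw [← Submodule.range_liftQ (LinearMap.ker ψ.toLinearMap) g.toLinearMap h]
  exact Module.Finite.iff_fg.mp inferInstance

variable {k B A : Type*} [Field k] [CommRing B] [Algebra k B] {P : PoissonBracket k B} [Ring A]
  [Algebra (PowerSeries k) A] (Q : Quantization P A)

/-- An element whose power maps `M` into `ħM` satisfies on `M` a monic polynomial equation with
lower coefficients divisible by `ħ`. -/
theorem exists_monic_aeval_apply_eq_zero {M : Type*} [AddCommGroup M]
    [Module (PowerSeries k) M] [Module.Finite (PowerSeries k) M]
    (f : Module.End (PowerSeries k) M) (hf : ∀ x, ∃ y, f x = (PowerSeries.X : PowerSeries k) • y) :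
    ∃ q : Polynomial (PowerSeries k), q.Monic ∧ (∀ i < q.natDegree, PowerSeries.X ∣ q.coeff i) ∧
      Polynomial.aeval f q = 0 := by
  obtain ⟨q, hq, -, hc, h0⟩ :=
    LinearMap.exists_monic_and_natDegree_eq_and_coeff_mem_pow_and_aeval_eq_zero (PowerSeries k) f
      (Ideal.span {PowerSeries.X}) (by
        rintro _ ⟨x, rfl⟩
        obtain ⟨y, hy⟩ := hf x
        rw [hy]
        exact Submodule.smul_mem_smul (Ideal.mem_span_singleton_self _) trivial)
  refine ⟨q, hq, fun i hi => ?_, h0⟩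
  rw [← Ideal.mem_span_singleton]
  exact Ideal.pow_le_self (by omega) (hc i)

/-- Central elements act on `W` by scalars. The map `ψ` stands for the action on an integral module:
since `g` kills its kernel, finiteness and the monic equations pass from `ψ` to `g`, and no lattice
in `W` is needed. -/
theorem Quantization.pow_dvd_finrank_of_irreducible (p : ℕ) [Fact p.Prime] [CharP k p]
    (hA : IsWeaklyCentral k p A) {O F W E : Type*} [CommRing O] [IsDomain O] [ValuationRing O]
    [Field F] [Algebra O F] [IsFractionRing O F] [Algebra (PowerSeries k) O]
    [Algebra (PowerSeries k) F] [IsScalarTower (PowerSeries k) O F]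
    (hX : algebraMap (PowerSeries k) O PowerSeries.X ∈ maximalIdeal O)
    (hX0 : algebraMap (PowerSeries k) O PowerSeries.X ≠ 0)
    (hres : ∀ u : O, ∃ c : k, u - algebraMap (PowerSeries k) O (PowerSeries.C c) ∈ maximalIdeal O)
    [AddCommGroup W] [Module F W] [Module O W] [Module (PowerSeries k) W] [IsScalarTower O F W]
    [IsScalarTower (PowerSeries k) F W] [IsScalarTower (PowerSeries k) O W]
    [FiniteDimensional F W] [Nontrivial W]
    [Ring E] [Algebra (PowerSeries k) E] (ψ : A →ₐ[PowerSeries k] E)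
    (hψ : (LinearMap.range ψ.toLinearMap).FG)
    (g : A →ₐ[PowerSeries k] Module.End F W) (hψg : ∀ a, ψ a = 0 → g a = 0)
    (hspan : Submodule.span F (Set.range g) = ⊤)
    {m : Ideal B} [m.IsMaximal] {n r : ℕ} (hr : 2 * n ≤ r) (x : Fin r → B)
    (hx : ∀ i, x i ∈ m) (h : (Matrix.of fun i j => P.bracket (x i) (x j)).det ∉ m)
    (hz : ∀ a, Q.ρ a ∈ m → ∃ e > 0, ∃ q : Polynomial (PowerSeries k), q.Monic ∧
      (∀ i < q.natDegree, PowerSeries.X ∣ q.coeff i) ∧ Polynomial.aeval (ψ a ^ e) q = 0) :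
    p ^ n ∣ Module.finrank F W := by
  have key := Q.pow_dvd_finrank_of_dense (O := O) (F := F) p hA hX hX0 hres g hspan
    (AlgHom.fg_range_of_ker_le ψ g hψg hψ) x hx h ?_
  -- `dim End_F W = (dim W)²`, so `p^(2n)` divides a square.
  · replace key := (pow_dvd_pow p hr).trans key
    rw [Module.finrank_linearMap, pow_mul', ← sq] at key
    exact (Nat.pow_dvd_pow_iff two_ne_zero).mp key
  · intro z hz0 hzm
    have hcen : g z ∈ Subalgebra.center F (Module.End F W) := by
      rw [Subalgebra.mem_center_iff]
      intro T
      have hT : T ∈ Submodule.span F (Set.range g) := hspan ▸ trivial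
      induction hT using Submodule.span_induction with
      | mem x hx =>
        obtain ⟨a, rfl⟩ := hx
        rw [← map_mul, ← map_mul, Subring.mem_center_iff.mp hz0 a]
      | zero => rw [zero_mul, mul_zero]
      | add x y _ _ hx hy => rw [add_mul, mul_add, hx, hy]
      | smul c x _ hx => rw [smul_mul_assoc, hx, mul_smul_comm]
    rw [Algebra.IsCentral.center_eq_bot F (Module.End F W)] at hcen
    obtain ⟨l, hl⟩ := Algebra.mem_bot.mp hcen
    obtain ⟨e, he, q, hq, hqc, hq0⟩ := hz z hzm
    have h1 : Polynomial.aeval (g z ^ e) q = 0 := by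
      rw [← map_pow, Polynomial.aeval_algHom_apply]
      apply hψg
      rw [← Polynomial.aeval_algHom_apply, map_pow, hq0]
    rw [← hl, ← map_pow, Polynomial.aeval_algebraMap_apply, FaithfulSMul.algebraMap_eq_zero_iff] at h1
    obtain ⟨u, hu, rfl⟩ := exists_mem_maximalIdeal_of_aeval_eq_zero (O := O) hX hq hqc he h1
    exact ⟨u, hu, by rw [← hl, ← IsScalarTower.algebraMap_apply]⟩

end IrreducibleRepresentations

/-! ### From simple modules to finite free modules over `k⟦ħ⟧`. -/

section FiniteFreeModules

open IsLocalRing TensorProduct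

/-- Restriction of the codomain of an `R`-algebra homomorphism to a subalgebra over an extension
of `R`. -/
def AlgHom.codRestrictScalars {R A E F : Type*} [CommRing R] [CommRing F] [Algebra R F] [Ring A]
    [Algebra R A] [Ring E] [Algebra R E] [Algebra F E] [IsScalarTower R F E] (f : A →ₐ[R] E)
    (S : Subalgebra F E) (h : ∀ a, f a ∈ S) : A →ₐ[R] S where
  toFun a := ⟨f a, h a⟩
  map_one' := Subtype.ext (map_one f)
  map_mul' a b := Subtype.ext (map_mul f a b)
  map_zero' := Subtype.ext (map_zero f)
  map_add' a b := Subtype.ext (map_add f a b)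
  commutes' r := Subtype.ext (f.commutes r)

/-- An algebra homomorphism over `R`, viewed as taking values in the algebra generated over an
extension `F` of `R` by its image. -/
def algHomAdjoin {R A E : Type*} (F : Type*) [CommRing R] [CommRing F] [Algebra R F] [Ring A]
    [Algebra R A] [Ring E] [Algebra R E] [Algebra F E] [IsScalarTower R F E] (f : A →ₐ[R] E) :
    A →ₐ[R] Algebra.adjoin F (Set.range f) :=
  f.codRestrictScalars (Algebra.adjoin F (Set.range f)) fun a => Algebra.subset_adjoin ⟨a, rfl⟩

/-- The range of `f` is closed under products, so its linear span is already the generated algebra.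
-/
theorem span_range_algHomAdjoin {R A E : Type*} (F : Type*) [CommRing R] [CommRing F]
    [Algebra R F] [Ring A] [Algebra R A] [Ring E] [Algebra R E] [Algebra F E]
    [IsScalarTower R F E] (f : A →ₐ[R] E) :
    Submodule.span F (Set.range (algHomAdjoin F f)) = ⊤ := by
  apply Submodule.map_injective_of_injective
    (Subalgebra.toSubmodule (Algebra.adjoin F (Set.range f))).injective_subtype
  rw [Submodule.map_span, ← Set.range_comp, Submodule.map_top, Submodule.range_subtype]
  have h : (Submonoid.closure (Set.range f) : Set E) = Set.range f := by
    rw [← AlgHom.coe_range]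
    exact congrArg SetLike.coe (Submonoid.closure_eq f.range.toSubmonoid)
  exact (congrArg (Submodule.span F) h.symm).trans (Algebra.adjoin_eq_span F (Set.range f)).symm

theorem algHomAdjoin_eq_zero {R A E : Type*} (F : Type*) [CommRing R] [CommRing F]
    [Algebra R F] [Ring A] [Algebra R A] [Ring E] [Algebra R E] [Algebra F E]
    [IsScalarTower R F E] (f : A →ₐ[R] E) {a : A} (h : f a = 0) : algHomAdjoin F f a = 0 :=
  Subtype.ext h

variable {k B A : Type*} [Field k] [CommRing B] [Algebra k B] {P : PoissonBracket k B} [Ring A]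
  [Algebra (PowerSeries k) A] (Q : Quantization P A)

theorem Quantization.pow_dvd_finrank_of_isSimpleModule (p : ℕ) [Fact p.Prime]
    [CharP k p] (hA : IsWeaklyCentral k p A) {O F : Type*} [CommRing O] [IsDomain O]
    [ValuationRing O] [Field F] [IsAlgClosed F] [Algebra O F] [IsFractionRing O F]
    [Algebra (PowerSeries k) O] [Algebra (PowerSeries k) F] [IsScalarTower (PowerSeries k) O F]
    (hX : algebraMap (PowerSeries k) O PowerSeries.X ∈ maximalIdeal O)
    (hX0 : algebraMap (PowerSeries k) O PowerSeries.X ≠ 0)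
    (hres : ∀ u : O, ∃ c : k, u - algebraMap (PowerSeries k) O (PowerSeries.C c) ∈ maximalIdeal O)
    {E S : Type*} [Ring E] [Algebra (PowerSeries k) E] (ψ : A →ₐ[PowerSeries k] E)
    (hψ : (LinearMap.range ψ.toLinearMap).FG) [Ring S] [Algebra F S] [Algebra (PowerSeries k) S]
    [IsScalarTower (PowerSeries k) F S] (f : A →ₐ[PowerSeries k] S)
    (hψf : ∀ a, ψ a = 0 → f a = 0) (hspan : Submodule.span F (Set.range f) = ⊤)
    {m : Ideal B} [m.IsMaximal] {n r : ℕ} (hr : 2 * n ≤ r) (x : Fin r → B)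
    (hx : ∀ i, x i ∈ m) (h : (Matrix.of fun i j => P.bracket (x i) (x j)).det ∉ m)
    (hz : ∀ a, Q.ρ a ∈ m → ∃ e > 0, ∃ q : Polynomial (PowerSeries k), q.Monic ∧
      (∀ i < q.natDegree, PowerSeries.X ∣ q.coeff i) ∧ Polynomial.aeval (ψ a ^ e) q = 0)
    (W : Type*) [AddCommGroup W] [Module F W] [Module S W] [IsScalarTower F S W]
    [FiniteDimensional F W] [IsSimpleModule S W] : p ^ n ∣ Module.finrank F W := by
  let _ : Module (PowerSeries k) W := Module.compHom W (algebraMap (PowerSeries k) F)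
  let _ : Module O W := Module.compHom W (algebraMap O F)
  have : IsScalarTower (PowerSeries k) F W := IsScalarTower.of_algebraMap_smul fun _ _ => rfl
  have : IsScalarTower O F W := IsScalarTower.of_algebraMap_smul fun _ _ => rfl
  have : IsScalarTower (PowerSeries k) O W := IsScalarTower.to₁₂₄ (PowerSeries k) O F W
  have : Nontrivial W := IsSimpleModule.nontrivial S W
  let g : A →ₐ[PowerSeries k] Module.End F W :=
    ((Algebra.lsmul F F W : S →ₐ[F] Module.End F W).restrictScalars (PowerSeries k)).comp f
  refine Q.pow_dvd_finrank_of_irreducible (O := O) (F := F) p hA hX hX0 hres ψ hψ g ?_ ?_ hr x hx h hz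
  · intro a ha
    change Algebra.lsmul F F W (f a) = 0
    rw [hψf a ha, map_zero]
  · have : Set.range g =
        (Algebra.lsmul F F W : S →ₐ[F] Module.End F W).toLinearMap '' Set.range f := by
      rw [← Set.range_comp]
      rfl
    rw [this, ← Submodule.map_span, hspan, Submodule.map_top, LinearMap.range_eq_top]
    exact IsSimpleModule.lsmul_surjective W

theorem Quantization.pow_dvd_finrank_of_algHom (p : ℕ) [Fact p.Prime]
    [CharP k p] (hA : IsWeaklyCentral k p A) {O F : Type*} [CommRing O] [IsDomain O]
    [ValuationRing O] [Field F] [IsAlgClosed F] [Algebra O F] [IsFractionRing O F]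
    [Algebra (PowerSeries k) O] [Algebra (PowerSeries k) F] [IsScalarTower (PowerSeries k) O F]
    (hX : algebraMap (PowerSeries k) O PowerSeries.X ∈ maximalIdeal O)
    (hX0 : algebraMap (PowerSeries k) O PowerSeries.X ≠ 0)
    (hres : ∀ u : O, ∃ c : k, u - algebraMap (PowerSeries k) O (PowerSeries.C c) ∈ maximalIdeal O)
    {E V : Type*} [Ring E] [Algebra (PowerSeries k) E] (ψ : A →ₐ[PowerSeries k] E)
    (hψ : (LinearMap.range ψ.toLinearMap).FG) [AddCommGroup V] [Module F V]
    [Module (PowerSeries k) V] [IsScalarTower (PowerSeries k) F V] [FiniteDimensional F V]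
    (f : A →ₐ[PowerSeries k] Module.End F V) (hψf : ∀ a, ψ a = 0 → f a = 0)
    {m : Ideal B} [m.IsMaximal] {n r : ℕ} (hr : 2 * n ≤ r) (x : Fin r → B)
    (hx : ∀ i, x i ∈ m) (h : (Matrix.of fun i j => P.bracket (x i) (x j)).det ∉ m)
    (hz : ∀ a, Q.ρ a ∈ m → ∃ e > 0, ∃ q : Polynomial (PowerSeries k), q.Monic ∧
      (∀ i < q.natDegree, PowerSeries.X ∣ q.coeff i) ∧ Polynomial.aeval (ψ a ^ e) q = 0) :
    p ^ n ∣ Module.finrank F V :=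
  dvd_finrank_of_forall_isSimpleModule (S := Algebra.adjoin F (Set.range f)) _
    (fun W _ _ _ _ _ _ => Q.pow_dvd_finrank_of_isSimpleModule p hA hX hX0 hres ψ hψ
      (algHomAdjoin F f) (fun a ha => algHomAdjoin_eq_zero F f (hψf a ha))
      (span_range_algHomAdjoin F f) hr x hx h hz W) V

theorem Quantization.pow_dvd_finrank_of_dominated (p : ℕ) [Fact p.Prime]
    [CharP k p] (hA : IsWeaklyCentral k p A) {O F : Type*} [CommRing O] [IsDomain O]
    [ValuationRing O] [Field F] [IsAlgClosed F] [Algebra O F] [IsFractionRing O F]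
    [Algebra (PowerSeries k) O] [Algebra (PowerSeries k) F] [IsScalarTower (PowerSeries k) O F]
    (hX : algebraMap (PowerSeries k) O PowerSeries.X ∈ maximalIdeal O)
    (hX0 : algebraMap (PowerSeries k) O PowerSeries.X ≠ 0)
    (hres : ∀ u : O, ∃ c : k, u - algebraMap (PowerSeries k) O (PowerSeries.C c) ∈ maximalIdeal O)
    (M : Type*) [AddCommGroup M] [Module A M]
    [Module (PowerSeries k) M] [IsScalarTower (PowerSeries k) A M]
    [Module.Finite (PowerSeries k) M] [Module.Free (PowerSeries k) M]
    {m : Ideal B} [m.IsMaximal] {n r : ℕ} (hr : 2 * n ≤ r) (x : Fin r → B)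
    (hx : ∀ i, x i ∈ m) (h : (Matrix.of fun i j => P.bracket (x i) (x j)).det ∉ m)
    (hM : ∀ a, Q.ρ a ∈ m → ∃ e > 0, ∀ v : M, ∃ w : M,
      a ^ e • v = (PowerSeries.X : PowerSeries k) • w) :
    p ^ n ∣ Module.finrank (PowerSeries k) M := by
  let ψ : A →ₐ[PowerSeries k] Module.End (PowerSeries k) M :=
    Algebra.lsmul (PowerSeries k) (PowerSeries k) M
  -- The rank of `M` is the dimension of `F ⊗ M`. The image of `A` in `End M` is finitely generated
  -- because `k⟦ħ⟧` is Noetherian.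
  rw [← Module.finrank_baseChange (R := F) (S := PowerSeries k) (M' := M)]
  refine Q.pow_dvd_finrank_of_algHom p hA hX hX0 hres ψ (IsNoetherian.noetherian _)
    ((Module.End.baseChangeHom (PowerSeries k) F M).comp ψ) (fun a ha => ?_) hr x hx h ?_
  · rw [AlgHom.comp_apply, ha, map_zero]
  · intro a ha
    obtain ⟨e, he, hea⟩ := hM a ha
    obtain ⟨q, hq⟩ := exists_monic_aeval_apply_eq_zero (ψ a ^ e) (fun v => by
      obtain ⟨w, hw⟩ := hea v
      exact ⟨w, by rw [← map_pow, ← hw]; rfl⟩)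
    exact ⟨e, he, q, hq⟩

/-- Ranks of modules over a weakly central quantization on which the elements above a maximal
ideal `m` act topologically nilpotently, at points where the bracket has rank at least `2n`. -/
theorem Quantization.pow_dvd_finrank_of_nilpotent [IsAlgClosed k] (p : ℕ) [Fact p.Prime]
    [CharP k p] (hA : IsWeaklyCentral k p A) (M : Type*) [AddCommGroup M] [Module A M]
    [Module (PowerSeries k) M] [IsScalarTower (PowerSeries k) A M]
    [Module.Finite (PowerSeries k) M] [Module.Free (PowerSeries k) M]
    {m : Ideal B} [m.IsMaximal] {n r : ℕ} (hr : 2 * n ≤ r) (x : Fin r → B)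
    (hx : ∀ i, x i ∈ m) (h : (Matrix.of fun i j => P.bracket (x i) (x j)).det ∉ m)
    (hM : ∀ a, Q.ρ a ∈ m → ∃ e > 0, ∀ v : M, ∃ w : M,
      a ^ e • v = (PowerSeries.X : PowerSeries k) • w) :
    p ^ n ∣ Module.finrank (PowerSeries k) M := by
  let K := FractionRing (PowerSeries k)
  let F := AlgebraicClosure K
  have : Algebra.IsAlgebraic (PowerSeries k) K := IsLocalization.isAlgebraic _ (nonZeroDivisors _)
  have : Algebra.IsAlgebraic (PowerSeries k) F := Algebra.IsAlgebraic.trans (PowerSeries k) K F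
  have : FaithfulSMul (PowerSeries k) F := FaithfulSMul.trans (PowerSeries k) K F
  obtain ⟨O, hO, hX, hres⟩ := exists_valuationSubring_residue k (F := F)
  let _ : Algebra (PowerSeries k) O :=
    ((algebraMap (PowerSeries k) F).codRestrict O.toSubring hO).toAlgebra
  have : IsScalarTower (PowerSeries k) O F := IsScalarTower.of_algebraMap_eq fun _ => rfl
  have hX0 : algebraMap (PowerSeries k) O PowerSeries.X ≠ 0 := fun h0 => by
    have : algebraMap (PowerSeries k) F PowerSeries.X = 0 := congrArg Subtype.val h0
    exact PowerSeries.X_ne_zero ((FaithfulSMul.algebraMap_eq_zero_iff _ _).mp this)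
  exact Q.pow_dvd_finrank_of_dominated (F := F) p hA hX hX0 hres M hr x hx h hM

/-- If `M / ħM` is supported at `y`, then every element above `y` has a power mapping `M` into
`ħM`. -/
theorem Quantization.exists_pow_smul_mem_of_support_subset (M : Type*) [AddCommGroup M] [Module A M]
    [Module (PowerSeries k) M] [IsScalarTower (PowerSeries k) A M]
    [Module.Finite (PowerSeries k) M] (y : PrimeSpectrum B)
    (hM : Module.support B (Q.Reduction M) ⊆ {y}) (a : A) (ha : Q.ρ a ∈ y.asIdeal) :
    ∃ e > 0, ∀ v : M, ∃ w : M, a ^ e • v = (PowerSeries.X : PowerSeries k) • w := by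
  classical
  have hmk : ∀ v : Q.Reduction M, ∃ u : M, (hbarSubmodule k A M).mkQ u = v :=
    Submodule.mkQ_surjective _
  -- Finiteness over `B` is what identifies the support with the zero locus of the annihilator.
  have hfin : Module.Finite B (Q.Reduction M) := by
    obtain ⟨s, hs⟩ := Module.Finite.fg_top (R := PowerSeries k) (M := M)
    refine ⟨⟨s.image fun u => (show Q.Reduction M from (hbarSubmodule k A M).mkQ u), ?_⟩⟩
    rw [eq_top_iff]
    rintro v -
    obtain ⟨u, rfl⟩ := hmk v
    have hu : u ∈ Submodule.span (PowerSeries k) (s : Set M) := hs ▸ trivial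
    induction hu using Submodule.span_induction with
    | mem u hu => exact Submodule.subset_span (Finset.mem_coe.mpr (Finset.mem_image_of_mem _ hu))
    | zero => rw [map_zero]; exact zero_mem _
    | add u v _ _ hu hv => rw [map_add]; exact add_mem hu hv
    | smul c u _ hu =>
      rw [← algebraMap_smul A c u, ← Q.ρ_smul_mk]
      exact Submodule.smul_mem _ _ hu
  rw [Module.support_eq_zeroLocus] at hM
  have h1 : Q.ρ a ∈ (Module.annihilator B (Q.Reduction M)).radical := by
    rw [← PrimeSpectrum.vanishingIdeal_zeroLocus_eq_radical]
    refine PrimeSpectrum.vanishingIdeal_anti_mono hM ?_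
    rwa [PrimeSpectrum.vanishingIdeal_singleton]
  obtain ⟨e, he⟩ := h1
  -- The exponent from the radical may be `0`, so it is raised by one to be positive.
  have h2 : Q.ρ (a ^ (e + 1)) ∈ Module.annihilator B (Q.Reduction M) := by
    rw [map_pow, pow_succ]
    exact Ideal.mul_mem_right _ _ he
  refine ⟨e + 1, Nat.succ_pos e, fun v => ?_⟩
  have h3 := Module.mem_annihilator.mp h2 ((hbarSubmodule k A M).mkQ v)
  erw [Q.ρ_smul_mk] at h3
  obtain ⟨w, hw⟩ := (Submodule.Quotient.mk_eq_zero _).mp h3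
  exact ⟨w, by rw [hw, algebraMap_smul]⟩

end FiniteFreeModules

/-! ### Cotangent spaces, differentials and heights at closed points. -/

section CotangentSpaces

open TensorProduct

variable {k C : Type*} [Field k] [CommRing C] [Algebra k C]

theorem Ideal.algebraMap_residueField_bijective [IsAlgClosed k] [Algebra.FiniteType k C]
    (q : Ideal C) [q.IsMaximal] : Function.Bijective (algebraMap k q.ResidueField) := by
  have h1 : Algebra.FiniteType C q.ResidueField :=
    Algebra.FiniteType.of_surjective (Algebra.ofId C q.ResidueField)
      q.algebraMap_residueField_surjective
  have : Algebra.FiniteType k q.ResidueField := Algebra.FiniteType.trans (S := C) ‹_› h1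
  have : Module.Finite k q.ResidueField := finite_of_finite_type_of_isJacobsonRing _ _
  exact IsAlgClosed.algebraMap_bijective_of_isIntegral

/-- At a closed point of a scheme of finite type over an algebraically closed field, the fibre of
the Kähler differentials is the cotangent space. -/
theorem nonempty_cotangent_equiv_fiber_kaehler [IsAlgClosed k] [Algebra.FiniteType k C]
    (q : Ideal C) [q.IsMaximal] :
    Nonempty (q.Cotangent ≃ₗ[k] q.ResidueField ⊗[C] Ω[C⁄k]) := by
  have hsurj := q.algebraMap_residueField_surjective
  have hbij := q.algebraMap_residueField_bijective (k := k)
  let κ := q.ResidueField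
  let e : k ≃ₐ[k] κ := AlgEquiv.ofBijective (Algebra.ofId k κ) hbij
  -- In the conormal sequence of `C → κ`, the vanishing of `Ω[κ⁄k]` gives surjectivity. The
  -- inclusion of constants `κ = k` splits the square-zero extension of `κ`, which gives
  -- injectivity.
  have hsub : Subsingleton (Ω[κ⁄k]) :=
    KaehlerDifferential.subsingleton_of_surjective k κ hbij.surjective
  have hinj : Function.Injective (KaehlerDifferential.kerCotangentToTensor k C κ) := by
    have hg : (IsScalarTower.toAlgHom k C κ).kerSquareLift.comp
        ((Algebra.ofId k _).comp e.symm.toAlgHom) = AlgHom.id k κ := by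
      refine AlgHom.ext fun x => ?_
      obtain ⟨c, rfl⟩ := e.surjective x
      have : e c = algebraMap k κ c := rfl
      rw [this, AlgHom.commutes, AlgHom.commutes]
    obtain ⟨l, hl⟩ := (retractionKerCotangentToTensorEquivSection hsurj).symm ⟨_, hg⟩
    exact Function.LeftInverse.injective (g := l) (LinearMap.congr_fun hl)
  have hsur : Function.Surjective (KaehlerDifferential.kerCotangentToTensor k C κ) := fun x =>
    (KaehlerDifferential.exact_kerCotangentToTensor_mapBaseChange k C κ hsurj x).mp
      (Subsingleton.elim _ _)
  have hJ : ∀ J : Ideal C, J = q → Nonempty (q.Cotangent ≃ₗ[k] J.Cotangent) := by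
    rintro _ rfl
    exact ⟨LinearEquiv.refl k _⟩
  obtain ⟨e₁⟩ := hJ _ q.ker_algebraMap_residueField
  exact ⟨e₁.trans ((LinearEquiv.ofBijective _ ⟨hinj, hsur⟩).restrictScalars k)⟩

theorem Ideal.finiteDimensional_cotangent [IsAlgClosed k] [Algebra.FiniteType k C]
    (q : Ideal C) [q.IsMaximal] : FiniteDimensional k q.Cotangent := by
  obtain ⟨e⟩ := nonempty_cotangent_equiv_fiber_kaehler (k := k) q
  have : Module.Finite k q.ResidueField :=
    Module.Finite.of_surjective (Algebra.linearMap k q.ResidueField)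
      q.algebraMap_residueField_bijective.surjective
  have : Module.Finite k (q.ResidueField ⊗[C] Ω[C⁄k]) := Module.Finite.trans q.ResidueField _
  exact Module.Finite.equiv e.symm

theorem finrank_cotangent_eq_rankAtStalk [IsAlgClosed k] [Algebra.FiniteType k C]
    (q : PrimeSpectrum C) [q.asIdeal.IsMaximal] (hq : q ∈ Module.freeLocus C Ω[C⁄k]) :
    Module.finrank k q.asIdeal.Cotangent = Module.rankAtStalk (R := C) (Ω[C⁄k]) q := by
  obtain ⟨e⟩ := nonempty_cotangent_equiv_fiber_kaehler (k := k) q.asIdeal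
  let κ := q.asIdeal.ResidueField
  let Cq := Localization.AtPrime q.asIdeal
  have hfree : Module.Free Cq (LocalizedModule q.asIdeal.primeCompl Ω[C⁄k]) := hq
  have : Module.Free Cq (Cq ⊗[C] Ω[C⁄k]) :=
    Module.Free.of_equiv (LocalizedModule.equivTensorProduct q.asIdeal.primeCompl Ω[C⁄k])
  have h1 : Module.finrank k κ = 1 :=
    (LinearEquiv.ofBijective (Algebra.linearMap k κ)
      (q.asIdeal.algebraMap_residueField_bijective)).finrank_eq.symm.trans (Module.finrank_self k)
  let e' : κ ⊗[Cq] (Cq ⊗[C] Ω[C⁄k]) ≃ₗ[κ] κ ⊗[C] Ω[C⁄k] :=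
    AlgebraTensorModule.cancelBaseChange _ _ _ _ _
  rw [e.finrank_eq, ← Module.finrank_mul_finrank k κ, h1, one_mul, ← e'.finrank_eq,
    Module.finrank_baseChange, Module.rankAtStalk_eq_finrank_tensorProduct]

theorem Ideal.exists_sub_sum_smul_mem_sq {ι : Type*} [Fintype ι] (q : Ideal C)
    (b : Module.Basis ι k q.Cotangent) {x : ι → q} (hx : ∀ i, q.toCotangent (x i) = b i)
    {g : C} (hg : g ∈ q) : ∃ d : ι → k, g - ∑ i, d i • (x i : C) ∈ q ^ 2 := by
  refine ⟨fun i => b.repr (q.toCotangent ⟨g, hg⟩) i, ?_⟩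
  have h := (Ideal.toCotangent_eq q (x := ⟨g, hg⟩)
    (y := ∑ i, b.repr (q.toCotangent ⟨g, hg⟩) i • x i)).mp (by
      rw [map_sum]
      conv_lhs => rw [← b.sum_repr (q.toCotangent ⟨g, hg⟩)]
      refine Finset.sum_congr rfl fun i _ => ?_
      rw [LinearMap.map_smul_of_tower, hx])
  simpa using h

/-- Lifts of a cotangent basis generate an ideal `J` with `q = J + q²`. By Nakayama `q` is minimal
over `J`, and Krull's height theorem applies. -/
theorem Ideal.height_le_finrank_cotangent [IsAlgClosed k] [Algebra.FiniteType k C]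
    (q : Ideal C) [q.IsMaximal] : q.height ≤ Module.finrank k q.Cotangent := by
  have : IsNoetherianRing C := Algebra.FiniteType.isNoetherianRing k C
  have := q.finiteDimensional_cotangent (k := k)
  let b := Module.finBasis k q.Cotangent
  choose x hx using fun i => q.toCotangent_surjective (b i)
  let J : Ideal C := Ideal.span (Set.range fun i => (x i : C))
  have hJq : J ≤ q := Ideal.span_le.mpr (by rintro _ ⟨i, rfl⟩; exact (x i).2)
  have hq : q ≤ J ⊔ q • q := by
    intro g hg
    obtain ⟨d, h2⟩ := q.exists_sub_sum_smul_mem_sq b hx hg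
    have h1 : (∑ i, d i • (x i : C)) ∈ J :=
      Submodule.sum_mem J fun i _ =>
        Submodule.smul_of_tower_mem J _ (Ideal.subset_span (Set.mem_range_self i))
    rw [sq] at h2
    rw [← add_sub_cancel (∑ i, d i • (x i : C)) g]
    exact Submodule.add_mem_sup h1 h2
  have hmin : q ∈ J.minimalPrimes := by
    refine ⟨⟨inferInstance, hJq⟩, ?_⟩
    rintro p ⟨hp, hJp⟩ hpq
    -- Nakayama for the image of `q` in `C ⧸ p` gives `r ≡ 1` modulo `q` with `r q ⊆ p`; as `r ∉ q`,
    -- primality forces `q ⊆ p`.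
    obtain ⟨r, hr1, hr⟩ := Submodule.exists_sub_one_mem_and_smul_eq_zero_of_fg_of_le_smul q
      (Submodule.map p.mkQ q) ((IsNoetherian.noetherian q).map _) (by
        rw [← Submodule.map_smul'']
        rintro _ ⟨g, hg, rfl⟩
        obtain ⟨u, hu, v, hv, rfl⟩ := Submodule.mem_sup.mp (hq hg)
        refine ⟨v, hv, ?_⟩
        rw [map_add, right_eq_add]
        exact (Submodule.Quotient.mk_eq_zero p).mpr (hJp hu))
    intro g hg
    have h1 : r * g ∈ p := (Submodule.Quotient.mk_eq_zero p).mp (hr _ ⟨g, hg, rfl⟩)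
    refine (hp.mem_or_mem h1).resolve_left fun hrp => ?_
    have : (1 : C) ∈ q := by
      rw [← sub_sub_cancel r 1]
      exact sub_mem (hpq hrp) hr1
    exact (Ideal.ne_top_iff_one q).mp (Ideal.IsMaximal.ne_top ‹_›) this
  refine (Ideal.height_le_spanRank_toENat_of_mem_minimalPrimes J q hmin).trans ?_
  refine (Cardinal.toENat.monotone' (Submodule.spanRank_span_le_card _)).trans ?_
  change (Set.range fun i => (x i : C)).encard ≤ _
  rw [← Set.image_univ]
  refine (Set.encard_image_le _ _).trans ?_
  rw [Set.encard_univ, ENat.card_eq_coe_fintype_card, Fintype.card_fin]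

end CotangentSpaces

/-! ### Nondegeneracy in terms of a bracket matrix. -/

section Nondegenerate

variable {k C : Type*} [Field k] [CommRing C] [Algebra k C]

/-- If the bracket is nondegenerate at a closed point, then lifts of a basis of the cotangent space
have an invertible matrix of brackets there. -/
theorem PoissonBracket.NondegenerateAt.exists_det_notMem [IsAlgClosed k] [Algebra.FiniteType k C]
    {P : PoissonBracket k C} {q : Ideal C} [q.IsMaximal] (h : P.NondegenerateAt q) :
    ∃ x : Fin (Module.finrank k q.Cotangent) → C, (∀ i, x i ∈ q) ∧
      (Matrix.of fun i j => P.bracket (x i) (x j)).det ∉ q := by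
  have := q.finiteDimensional_cotangent (k := k)
  let b := Module.finBasis k q.Cotangent
  choose x hx using fun i => q.toCotangent_surjective (b i)
  refine ⟨fun i => x i, fun i => (x i).2, fun hdet => ?_⟩
  let κ := q.ResidueField
  set G : Matrix (Fin (Module.finrank k q.Cotangent)) (Fin (Module.finrank k q.Cotangent)) C :=
    Matrix.of fun i j => P.bracket (x i) (x j) with hG
  have hker : ∀ c : C, algebraMap C κ c = 0 ↔ c ∈ q := fun c => by
    rw [← RingHom.mem_ker, q.ker_algebraMap_residueField]
  have h0 : ((algebraMap C κ).mapMatrix G).det = 0 := by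
    rw [← RingHom.map_det, hker]
    exact hdet
  -- A vector in the kernel of the matrix modulo `q` yields `f` whose brackets with the `x j`, hence
  -- with all of `q`, lie in `q`. Nondegeneracy puts `f` in `q²`, contradicting independence of the
  -- basis.
  obtain ⟨v, hv, hv0⟩ := Matrix.exists_vecMul_eq_zero_iff.mpr h0
  choose c hc using fun i => (q.algebraMap_residueField_bijective (k := k)).surjective (v i)
  set f : q := ∑ i, c i • x i with hf
  have hfx : ∀ j, P.bracket f (x j) ∈ q := by
    intro j
    have h1 : P.bracket f (x j) = ∑ i, c i • P.bracket (x i) (x j) := by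
      have : P.bracket (x j) f = ∑ i, c i • P.bracket (x j) (x i) := by
        rw [← P.hamiltonian_apply, hf]
        simp
      rw [P.bracket_swap, this, ← Finset.sum_neg_distrib]
      refine Finset.sum_congr rfl fun i _ => ?_
      rw [P.bracket_swap (x j), smul_neg, neg_neg]
    rw [← hker, h1, map_sum]
    have h2 := congrFun hv0 j
    rw [Matrix.vecMul, dotProduct] at h2
    rw [← Pi.zero_apply (M := fun _ => κ) j, ← h2]
    refine Finset.sum_congr rfl fun i _ => ?_
    rw [Algebra.smul_def, map_mul, ← IsScalarTower.algebraMap_apply, hc]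
    rfl
  have hsq : ∀ g ∈ q ^ 2, P.bracket f g ∈ q := by
    intro g hg
    rw [sq] at hg
    induction hg using Submodule.mul_induction_on' with
    | mem_mul_mem a ha b hb =>
      rw [P.leibniz]
      exact add_mem (Ideal.mul_mem_left _ _ hb) (Ideal.mul_mem_right _ _ ha)
    | add a _ b _ ha hb => rw [P.add_right]; exact add_mem ha hb
  have hall : ∀ g ∈ q, P.bracket f g ∈ q := by
    intro g hg
    obtain ⟨d, h2⟩ := q.exists_sub_sum_smul_mem_sq b hx hg
    rw [← add_sub_cancel (∑ i, d i • (x i : C)) g, P.add_right]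
    refine add_mem ?_ (hsq _ h2)
    rw [← P.hamiltonian_apply, map_sum]
    refine Submodule.sum_mem q fun i _ => ?_
    rw [Derivation.map_smul]
    exact Submodule.smul_of_tower_mem q _ (hfx i)
  have hfsq := h f f.2 hall
  rw [← Ideal.toCotangent_eq_zero, hf, map_sum] at hfsq
  have hzero : ∑ i, c i • b i = 0 := by
    rw [← hfsq]
    refine Finset.sum_congr rfl fun i _ => ?_
    rw [LinearMap.map_smul_of_tower, hx]
  refine hv (funext fun i => ?_)
  rw [← hc, Fintype.linearIndependent_iff.mp b.linearIndependent c hzero i, map_zero]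
  rfl

end Nondegenerate

/-! ### Dimension of the leaf and the rank of the bracket. -/

section SymplecticLeaves

open TopologicalSpace Topology

/-- In a locally closed subset of dimension at least `d` of a Jacobson spectrum there is a closed
point whose ideal has height at least `d` in the coordinate ring of the closure. -/
theorem exists_isMaximal_le_height {B C : Type*} [CommRing B] [CommRing C] [IsJacobsonRing B]
    {Y : Set (PrimeSpectrum B)} (hY : IsLocallyClosed Y) {e : PrimeSpectrum C → PrimeSpectrum B}
    (he : IsEmbedding e) {f : Y → PrimeSpectrum C} (hfe : ∀ y, e (f y) = y) {d : ℕ}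
    (hd : (d : WithBot ℕ∞) ≤ topologicalKrullDim Y) :
    ∃ y : Y, (f y).asIdeal.IsMaximal ∧ (d : ℕ∞) ≤ (f y).asIdeal.height := by
  have hcomp : e ∘ f = Subtype.val := funext hfe
  have hf : IsInducing f := he.isInducing.of_comp_iff.mp (hcomp ▸ IsInducing.subtypeVal)
  obtain ⟨l, hl⟩ := Order.le_krullDim_iff.mp hd
  -- The smallest member of the chain contains a closed point of `Spec B` by the Jacobson property,
  -- and this point lies in every other member.
  let Z : IrreducibleCloseds Y := l.head
  have hZ : IsLocallyClosed (Subtype.val '' (Z : Set Y)) :=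
    Z.isClosed.isLocallyClosed.image IsInducing.subtypeVal (by rwa [Subtype.range_val])
  obtain ⟨_, ⟨y, hyZ, rfl⟩, hyc⟩ :=
    nonempty_inter_closedPoints (Z.isIrreducible.nonempty.image _) hZ
  refine ⟨y, ?_, ?_⟩
  · rw [← PrimeSpectrum.isClosed_singleton_iff_isMaximal]
    refine preimage_closedPoints_subset he.injective he.continuous ?_
    rw [Set.mem_preimage, hfe]
    exact hyc
  -- Passing to generic points of closures reverses inclusions, so the reversed chain is a chain of
  -- primes ending below `f y`.
  · let φ : IrreducibleCloseds Y → (PrimeSpectrum C)ᵒᵈ := fun W => OrderDual.toDual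
      ((PrimeSpectrum.pointsEquivIrreducibleCloseds C).symm
        (OrderDual.toDual (IrreducibleCloseds.map f hf.continuous W)))
    have hφ : StrictMono φ := fun W W' h => by
      have := IrreducibleCloseds.map_strictMono_of_isInducing hf h
      exact (PrimeSpectrum.pointsEquivIrreducibleCloseds C).symm.strictMono
        (OrderDual.toDual_lt_toDual.mpr this)
    let l' : LTSeries (PrimeSpectrum C) := (l.map φ hφ).reverse
    rw [PrimeSpectrum.height_eq_orderHeight]
    have hlast : l'.last ≤ f y := by
      have hlast : l'.last = (PrimeSpectrum.pointsEquivIrreducibleCloseds C).symm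
          (OrderDual.toDual (IrreducibleCloseds.map f hf.continuous Z)) := by
        exact (RelSeries.last_reverse (l.map φ hφ)).trans rfl
      set p := l'.last
      have h1 : PrimeSpectrum.pointsEquivIrreducibleCloseds C p =
          OrderDual.toDual (IrreducibleCloseds.map f hf.continuous Z) := by
        rw [hlast, OrderIso.apply_symm_apply]
      have h2 : closure {p} = closure (f '' Z) :=
        congrArg IrreducibleCloseds.carrier (OrderDual.toDual_inj.mp h1)
      rw [PrimeSpectrum.le_iff_specializes, specializes_iff_mem_closure, h2]
      exact subset_closure ⟨y, hyZ, rfl⟩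
    have := Order.length_le_height hlast
    rwa [show l'.length = d from hl] at this

namespace PoissonBracket

variable {k B : Type*} [Field k] [IsAlgClosed k] [CommRing B] [Algebra k B]
  [Algebra.FiniteType k B] {P : PoissonBracket k B} {Y : Set (PrimeSpectrum B)}

/-- At a closed point of a symplectic subvariety of dimension at least `d` there are at least `d`
functions vanishing at the point with invertible matrix of brackets there. -/
theorem IsSymplecticSubvariety.exists_det_notMem (hY : P.IsSymplecticSubvariety Y)
    {y : PrimeSpectrum B} (hy : y.asIdeal.IsMaximal) (hyY : y ∈ Y) {d : ℕ}
    (hd : (d : WithBot ℕ∞) ≤ topologicalKrullDim Y) :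
    ∃ r, d ≤ r ∧ ∃ x : Fin r → B, (∀ i, x i ∈ y.asIdeal) ∧
      (Matrix.of fun i j => P.bracket (x i) (x j)).det ∉ y.asIdeal := by
  set I := PrimeSpectrum.vanishingIdeal (closure Y) with hI
  let e : PrimeSpectrum (B ⧸ I) → PrimeSpectrum B := PrimeSpectrum.comap (Ideal.Quotient.mk I)
  have he : IsClosedEmbedding e :=
    PrimeSpectrum.isClosedEmbedding_comap_of_surjective _ _ Ideal.Quotient.mk_surjective
  have hrange : Set.range e = closure Y := by
    rw [range_comap_of_surjective _ _ Ideal.Quotient.mk_surjective, Ideal.mk_ker, hI,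
      PrimeSpectrum.zeroLocus_vanishingIdeal_eq_closure, closure_closure]
  have hex : ∀ y : Y, ∃ q, e q = y := fun y => by
    have : (y : PrimeSpectrum B) ∈ Set.range e := hrange ▸ subset_closure y.2
    exact this
  choose f hfe using hex
  have hcomp : e ∘ f = Subtype.val := funext hfe
  have hf : IsInducing f := he.isInducing.of_comp_iff.mp (hcomp ▸ IsInducing.subtypeVal)
  have hmem : ∀ y, e (f y) ∈ Y := fun y => by rw [hfe]; exact y.2
  have : IsNoetherianRing B := Algebra.FiniteType.isNoetherianRing k B
  have : IsJacobsonRing B := isJacobsonRing_of_finiteType (A := k)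
  have hfree : ∀ y, f y ∈ Module.freeLocus (B ⧸ I) Ω[(B ⧸ I)⁄k] := fun y => by
    have h : f y ∈ Algebra.smoothLocus k (B ⧸ I) := hY.smooth (f y) (hmem y)
    rw [Algebra.smoothLocus_eq_compl_support_inter] at h
    exact h.2
  have : PreconnectedSpace Y := isPreconnected_iff_preconnectedSpace.mp hY.isConnected.isPreconnected
  have hfp : Module.FinitePresentation (B ⧸ I) Ω[(B ⧸ I)⁄k] :=
    Module.finitePresentation_of_finite (B ⧸ I) _
  -- The dimension bound is available only at some closed point `z` of `Y`. Smoothness makes the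
  -- differentials locally free along `Y`, and connectedness carries the cotangent dimension from
  -- `z` to `y`.
  have hconst : ∀ y y' : Y, Module.rankAtStalk (R := B ⧸ I) Ω[(B ⧸ I)⁄k] (f y) =
      Module.rankAtStalk (R := B ⧸ I) Ω[(B ⧸ I)⁄k] (f y') := fun y y' =>
    ((Module.isLocallyConstant_rankAtStalk_freeLocus (R := B ⧸ I)
      (M := Ω[(B ⧸ I)⁄k])).comp_continuous
      (hf.continuous.subtype_mk hfree)).apply_eq_of_preconnectedSpace y y'
  obtain ⟨z, hz, hzd⟩ := exists_isMaximal_le_height hY.isLocallyClosed he.isEmbedding hfe hd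
  let q := f ⟨y, hyY⟩
  have hqy : e q = y := hfe ⟨y, hyY⟩
  have hq : q.asIdeal.IsMaximal := by
    rw [← PrimeSpectrum.isClosed_singleton_iff_isMaximal] at hy ⊢
    refine preimage_closedPoints_subset he.injective he.continuous ?_
    rw [Set.mem_preimage, hqy]
    exact hy
  obtain ⟨x, hx, hdet⟩ := (hY.nondegenerate q (hmem _) hq).exists_det_notMem
  have hmemy : ∀ b, b ∈ y.asIdeal ↔ Ideal.Quotient.mk I b ∈ q.asIdeal := fun b => by
    rw [← hqy]
    rfl
  refine ⟨_, ?_, fun i => (Ideal.Quotient.mk_surjective (x i)).choose, fun i => ?_, ?_⟩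
  · have h1 := hzd.trans ((f z).asIdeal.height_le_finrank_cotangent (k := k))
    rw [finrank_cotangent_eq_rankAtStalk (f z) (hfree z), hconst z ⟨y, hyY⟩,
      ← finrank_cotangent_eq_rankAtStalk (k := k) q (hfree _)] at h1
    exact_mod_cast h1
  · rw [hmemy, (Ideal.Quotient.mk_surjective (x i)).choose_spec]
    exact hx i
  · rw [hmemy, RingHom.map_det]
    convert hdet using 3
    ext i j
    conv_rhs => rw [Matrix.of_apply, ← (Ideal.Quotient.mk_surjective (x i)).choose_spec,
      ← (Ideal.Quotient.mk_surjective (x j)).choose_spec]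
    rfl

end PoissonBracket

end SymplecticLeaves

theorem mainTheorem4
    {k : Type*} [Field k] [IsAlgClosed k] (p : ℕ) [Fact p.Prime] [CharP k p] (hp : 2 < p)
    {B : Type*} [CommRing B] [Algebra k B] [Algebra.FiniteType k B]
    (P : PoissonBracket k B)
    {A : Type*} [Ring A] [Algebra (PowerSeries k) A]
    (Q : Quantization P A) (hA : IsWeaklyCentral k p A)
    (y : PrimeSpectrum B) (hy : y.asIdeal.IsMaximal)
    (Y : Set (PrimeSpectrum B)) (hY : P.IsSymplecticLeaf Y) (hyY : y ∈ Y)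
    (n : ℕ) (hn : topologicalKrullDim Y = ((2 * n : ℕ) : WithBot ℕ∞))
    (M : Type*) [AddCommGroup M] [Module A M] [Module (PowerSeries k) M]
    [IsScalarTower (PowerSeries k) A M]
    [Module.Finite (PowerSeries k) M] [Module.Free (PowerSeries k) M]
    (hM : Module.support B (Q.Reduction M) ⊆ {y}) :
    p ^ n ∣ Module.finrank (PowerSeries k) M := by
  obtain ⟨r, hr, x, hx, hdet⟩ := hY.prop.exists_det_notMem hy hyY (d := 2 * n) hn.ge
  exact Q.pow_dvd_finrank_of_nilpotent p hA M hr x hx hdet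
    (Q.exists_pow_smul_mem_of_support_subset M y hM)
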